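/- **Setting.** All Hilbert spaces are finite-dimensional and $\log=\log_2$. Alice and Bob transform joint states by protocols: starting from a joint state, they alternate, any number of times and in any order, arbitrary local quantum channels (completely positive trace-preserving maps applied by Alice to her part or by Bob to his part, possibly changing dimensions; these are free) and transmissions of one qubit or one classical bit in either direction (each costs $1$). The Uhlmann fidelity is $F(\rho,\sigma)=\operatorname{Tr}(\rho^{1/2}\sigma\rho^{1/2})^{1/2}$. For bipartite pure states $\varphi_{AB}$, $\psi_{AB}$ and $0\le\epsilon<1$, the transformation complexity $\bar Q_\epsilon(\psi|\varphi)$ is the minimum total number of communicated bits (quantum and classical) of a protocol that takes $|\varphi\rangle\langle\varphi|$ to a (possibly mixed) state $\psi'$ with $F(\psi,\psi')>1-\epsilon$ (for $\epsilon=0$: with $\psi'=\psi$). The EPR-enhanced transformation complexity is $$\bar Q^{(*)}_\epsilon(\psi|\varphi)=\inf_{k\ge 1}\ \bar Q_\epsilon(\psi\otimes\Phi^k\,|\,\varphi\otimes\Phi^k),\qquad |\Phi^k_{AB}\rangle=\tfrac1{\sqrt k}\sum_{j=1}^k|j,j\rangle .$$ For a density matrix $\rho$ with eigenvalues $\lambda_i$,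 the Rényi entropies are $S_\alpha(\rho)=\frac1{1-\alpha}\log\sum_i\lambda_i^\alpha$ for $0<\alpha<\infty$, $\alpha\ne1$, and $S_\infty(\rho)=-\log\max_i\lambda_i$. Write $\psi_A=\operatorname{Tr}_B|\psi\rangle\langle\psi|$ and $\varphi_A=\operatorname{Tr}_B|\varphi\rangle\langle\varphi|$. **Theorem.** For any bipartite pure states $\varphi_{AB}$ and $\psi_{AB}$, any $0\le\epsilon<1$ and any $1/2\le\alpha<1$, $$\bar Q^{(*)}_\epsilon(\psi|\varphi)\ \ge\ S_\beta(\psi_A)-S_\alpha(\varphi_A)+\frac{2\alpha}{1-\alpha}\log(1-\epsilon),$$ where $\beta=\infty$ if $\alpha=1/2$ and $\beta=\alpha/(2\alpha-1)$ otherwise. In particular, the bound does not depend on the dimension $k$ of the shared maximally entangled state. -/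

import Mathlib

open scoped ENNReal Kronecker ComplexOrder

noncomputable section

/-! ### States -/

/-- A bipartite pure state `|ψ_AB⟩ = ∑ ψ(a,b) |a⟩|b⟩`: a unit vector of `ℂ^A ⊗ ℂ^B`. -/
structure PureState (A B : Type) [Fintype A] [Fintype B] where
  amp : A × B → ℂ
  normalized : ∑ x, ‖amp x‖ ^ 2 = 1

/-- A density matrix: positive semidefinite with unit trace. -/
structure DensityMatrix (A : Type) [Fintype A] where
  mat : Matrix A A ℂ
  posSemidef : mat.PosSemidef
  trace_eq_one : mat.trace = 1

/-- The partial trace `Tr_B`. -/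
def partialTraceB {A B : Type} [Fintype B] (M : Matrix (A × B) (A × B) ℂ) : Matrix A A ℂ :=
  Matrix.of fun a a' => ∑ b, M (a, b) (a', b)

/-- The projector `|ψ⟩⟨ψ|`. -/
def PureState.proj {A B : Type} [Fintype A] [Fintype B] (ψ : PureState A B) :
    Matrix (A × B) (A × B) ℂ :=
  Matrix.vecMulVec ψ.amp (star ψ.amp)

/-- The reduced density matrix `ψ_A = Tr_B |ψ⟩⟨ψ|`. -/
def PureState.reducedA {A B : Type} [Fintype A] [Fintype B] (ψ : PureState A B) :
    DensityMatrix A where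
  mat := partialTraceB ψ.proj
  posSemidef := by
    have h : partialTraceB ψ.proj
        = ∑ b, Matrix.vecMulVec (fun a => ψ.amp (a, b)) (star fun a => ψ.amp (a, b)) := by
      ext a a'
      simp [partialTraceB, PureState.proj, Matrix.vecMulVec_apply, Matrix.sum_apply]
    rw [h]
    exact Matrix.posSemidef_sum _ fun b _ => Matrix.posSemidef_vecMulVec_self_star _
  trace_eq_one := by
    have h := ψ.normalized
    rw [Fintype.sum_prod_type] at h
    have h2 := congrArg (fun x : ℝ => (x : ℂ)) h
    push_cast at h2
    simpa [Matrix.trace, partialTraceB, PureState.proj, Matrix.vecMulVec_apply,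
      Complex.mul_conj'] using h2

/-- The tensor product `|φ_{AB}⟩ ⊗ |ω_{A'B'}⟩`, with Alice holding `A A'` and Bob `B B'`. -/
def PureState.tensor {A B A' B' : Type} [Fintype A] [Fintype B] [Fintype A'] [Fintype B']
    (φ : PureState A B) (ω : PureState A' B') : PureState (A × A') (B × B') where
  amp x := φ.amp (x.1.1, x.2.1) * ω.amp (x.1.2, x.2.2)
  normalized := by
    have h : (∑ x, ‖φ.amp x‖ ^ 2) * (∑ y, ‖ω.amp y‖ ^ 2) = 1 := by
      rw [φ.normalized, ω.normalized, one_mul]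
    rw [Fintype.sum_mul_sum, ← Fintype.sum_prod_type'] at h
    rw [← h]
    refine Fintype.sum_equiv (Equiv.prodProdProdComm A A' B B') _ _ fun x => ?_
    simp [mul_pow]

/-- The maximally entangled state `|Φ^k⟩ = k^{-1/2} ∑_j |j,j⟩` of rank `k ≥ 1`. -/
def maxEntangled (k : ℕ) (hk : 0 < k) : PureState (Fin k) (Fin k) where
  amp x := if x.1 = x.2 then ((1 / Real.sqrt k : ℝ) : ℂ) else 0
  normalized := by
    have hk' : (k : ℝ) ≠ 0 := by positivity
    rw [Fintype.sum_prod_type]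
    simp [apply_ite, hk']

/-! ### Rényi entropies and fidelity -/

/-- The Rényi entropy `S_α(ρ)` (in bits) of order `α ∈ [0, ∞]`, through the spectrum of `ρ`. -/
def renyiEntropy {A : Type} [Fintype A] [DecidableEq A] (α : ℝ≥0∞) (ρ : DensityMatrix A) : ℝ :=
  if α = 0 then Real.logb 2 ρ.mat.rank
  else if α = 1 then
    -∑ i, ρ.posSemidef.isHermitian.eigenvalues i *
      Real.logb 2 (ρ.posSemidef.isHermitian.eigenvalues i)
  else if α = ∞ then -Real.logb 2 (⨆ i, ρ.posSemidef.isHermitian.eigenvalues i)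
  else 1 / (1 - α.toReal) *
    Real.logb 2 (∑ i, ρ.posSemidef.isHermitian.eigenvalues i ^ α.toReal)

/-- The Uhlmann fidelity `F(ρ,σ) = Tr (ρ^{1/2} σ ρ^{1/2})^{1/2}`; square roots are those of the
continuous functional calculus. -/
def fidelity {A : Type} [Fintype A] [DecidableEq A] (ρ σ : Matrix A A ℂ) : ℝ :=
  (cfc Real.sqrt (cfc Real.sqrt ρ * σ * cfc Real.sqrt ρ)).trace.re

/-! ### Communication protocols -/

/-- Complete dephasing, in the computational basis, of the last qubit in Alice's hands: this is
what happens to a qubit that is transmitted as a classical bit. -/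
def dephaseA {A B : Type} (ρ : Matrix ((A × Fin 2) × B) ((A × Fin 2) × B) ℂ) :
    Matrix ((A × Fin 2) × B) ((A × Fin 2) × B) ℂ :=
  Matrix.of fun x y => if x.1.2 = y.1.2 then ρ x y else 0

/-- Complete dephasing of the first qubit in Bob's hands. -/
def dephaseB {A B : Type} (ρ : Matrix (A × (Fin 2 × B)) (A × (Fin 2 × B)) ℂ) :
    Matrix (A × (Fin 2 × B)) (A × (Fin 2 × B)) ℂ :=
  Matrix.of fun x y => if x.2.1 = y.2.1 then ρ x y else 0

/-- `Reachable ρ₀ A B ρ n`: starting from the joint state `ρ₀` of Alice and Bob, some protocol in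
which a total of `n` qubits and classical bits are communicated (in either direction, in any
number of rounds) leaves them in the joint state `ρ`, Alice holding `A` and Bob holding `B`.
Local operations are free: they are arbitrary quantum channels
`ρ ↦ ∑ i, K i ρ (K i)ᴴ` with `∑ i, (K i)ᴴ K i = 1`, possibly between spaces of different dimension,
and thus include adjoining ancillas, unitaries, measurements and discarding subsystems. -/
inductive Reachable {A₀ B₀ : Type} [Fintype A₀] [Fintype B₀]
    (ρ₀ : Matrix (A₀ × B₀) (A₀ × B₀) ℂ) :
    (A B : Type) → [Fintype A] → [Fintype B] → Matrix (A × B) (A × B) ℂ → ℕ → Prop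
  | init : Reachable ρ₀ A₀ B₀ ρ₀ 0
  | localA {A B A' : Type} [Fintype A] [Fintype B] [Fintype A'] [DecidableEq A] [DecidableEq B]
      {ρ : Matrix (A × B) (A × B) ℂ} {n r : ℕ} (K : Fin r → Matrix A' A ℂ)
      (hK : ∑ i, (K i).conjTranspose * K i = 1) (h : Reachable ρ₀ A B ρ n) :
      Reachable ρ₀ A' B
        (∑ i, (K i ⊗ₖ (1 : Matrix B B ℂ)) * ρ * (K i ⊗ₖ (1 : Matrix B B ℂ)).conjTranspose) n
  | localB {A B B' : Type} [Fintype A] [Fintype B] [Fintype B'] [DecidableEq A] [DecidableEq B]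
      {ρ : Matrix (A × B) (A × B) ℂ} {n r : ℕ} (K : Fin r → Matrix B' B ℂ)
      (hK : ∑ i, (K i).conjTranspose * K i = 1) (h : Reachable ρ₀ A B ρ n) :
      Reachable ρ₀ A B'
        (∑ i, ((1 : Matrix A A ℂ) ⊗ₖ K i) * ρ * ((1 : Matrix A A ℂ) ⊗ₖ K i).conjTranspose) n
  | qubitAB {A B : Type} [Fintype A] [Fintype B]
      {ρ : Matrix ((A × Fin 2) × B) ((A × Fin 2) × B) ℂ} {n : ℕ}
      (h : Reachable ρ₀ (A × Fin 2) B ρ n) :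
      Reachable ρ₀ A (Fin 2 × B)
        (ρ.submatrix (Equiv.prodAssoc A (Fin 2) B).symm (Equiv.prodAssoc A (Fin 2) B).symm) (n + 1)
  | qubitBA {A B : Type} [Fintype A] [Fintype B]
      {ρ : Matrix (A × (Fin 2 × B)) (A × (Fin 2 × B)) ℂ} {n : ℕ}
      (h : Reachable ρ₀ A (Fin 2 × B) ρ n) :
      Reachable ρ₀ (A × Fin 2) B
        (ρ.submatrix (Equiv.prodAssoc A (Fin 2) B) (Equiv.prodAssoc A (Fin 2) B)) (n + 1)
  | bitAB {A B : Type} [Fintype A] [Fintype B]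
      {ρ : Matrix ((A × Fin 2) × B) ((A × Fin 2) × B) ℂ} {n : ℕ}
      (h : Reachable ρ₀ (A × Fin 2) B ρ n) :
      Reachable ρ₀ A (Fin 2 × B)
        ((dephaseA ρ).submatrix (Equiv.prodAssoc A (Fin 2) B).symm
          (Equiv.prodAssoc A (Fin 2) B).symm) (n + 1)
  | bitBA {A B : Type} [Fintype A] [Fintype B]
      {ρ : Matrix (A × (Fin 2 × B)) (A × (Fin 2 × B)) ℂ} {n : ℕ}
      (h : Reachable ρ₀ A (Fin 2 × B) ρ n) :
      Reachable ρ₀ (A × Fin 2) B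
        ((dephaseB ρ).submatrix (Equiv.prodAssoc A (Fin 2) B) (Equiv.prodAssoc A (Fin 2) B)) (n + 1)

/-! ### Transformation complexities -/

/-- The state `ρ` approximates `σ` with error `ε`: `F(σ,ρ) > 1 - ε`, and equality for `ε = 0`. -/
def Approximates {A : Type} [Fintype A] [DecidableEq A] (ε : ℝ) (σ ρ : Matrix A A ℂ) : Prop :=
  fidelity σ ρ > 1 - ε ∨ (ε = 0 ∧ ρ = σ)

/-- The transformation complexity `Q̄_ε(ψ|φ)`: the minimum number of bits of communication that
takes `φ` to a (possibly mixed) state that approximates `ψ`. -/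
def transformationComplexity {A₀ B₀ A B : Type} [Fintype A₀] [Fintype B₀] [Fintype A] [Fintype B]
    [DecidableEq A] [DecidableEq B] (ε : ℝ) (ψ : PureState A B) (φ : PureState A₀ B₀) : ℕ∞ :=
  ⨅ (n : ℕ) (_ : ∃ ρ : Matrix (A × B) (A × B) ℂ,
    Reachable φ.proj A B ρ n ∧ Approximates ε ψ.proj ρ), (n : ℕ∞)

/-- The EPR-enhanced transformation complexity
`Q̄_ε^(*)(ψ|φ) = inf_k Q̄_ε(ψ ⊗ Φ^k | φ ⊗ Φ^k)`, over the maximally entangled states of any rank. -/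
def eprTransformationComplexity {A₀ B₀ A B : Type} [Fintype A₀] [Fintype B₀] [Fintype A]
    [Fintype B] [DecidableEq A] [DecidableEq B] (ε : ℝ) (ψ : PureState A B)
    (φ : PureState A₀ B₀) : ℕ∞ :=
  ⨅ (k : ℕ) (hk : 0 < k),
    transformationComplexity ε (ψ.tensor (maxEntangled k hk)) (φ.tensor (maxEntangled k hk))

/-- The order `β` paired with `α`: `β = ∞` if `α = 1/2` and `β = α / (2α - 1)` otherwise. -/
def conjOrder (α : ℝ) : ℝ≥0∞ :=
  if α = 1 / 2 then ∞ else ENNReal.ofReal (α / (2 * α - 1))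

end

/-!
Let `θ = 1 / α - 1`, so that `0 < θ ≤ 1`, and let `p = 2α` and `q = 2β` be the conjugate exponents
`2 / (1 + θ)` and `2 / (1 - θ)`. If a bipartite pure state is read as its matrix `M` of amplitudes,
then `2 log ‖M‖_p = θ S_α` and `2 log ‖M‖_q = -θ S_β` for the entropies of its reduced state. The
theorem thus reads `F ^ 2 ≤ 2 ^ (n θ) ‖φ‖_p ^ 2 ‖ψ‖_q ^ 2` for protocols that communicate `n` bits.

Every state that a protocol reaches is purified by environments that stay with Alice and with Bob,
and the invariant `PurifiedLE` bounds the `p`-norm of the amplitude matrix of this purification.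
Local channels multiply it by isometries, which do not increase the norm (`PurifiedLE.localA`,
`PurifiedLE.localB`). A transmitted bit is a dephasing, which is a local channel, followed by a
transmitted qubit. A transmitted qubit moves an index of dimension two from the rows to the columns
or back, and this costs at most the factor `2 ^ θ` in the squared norm (`SchattenLE.toCol`,
`SchattenLE.toRow`).

The `p`-norm is handled by duality with the `q`-norm, and the `q`-norm by the variational formula
`‖Y‖_q ^ 2 = sup Tr (σ ^ θ Y Yᴴ)` over density matrices `σ`, see `SchattenLE` and `SchattenDualLE`.
In this form the estimate for a qubit follows from `σ ≤ 2 (Tr₂ σ) ⊗ 1` and the operator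
monotonicity of `t ↦ t ^ θ` (`sum_rpow_mul_le_of_sum_mul_le`).

In the end, the fidelity of a pure state `ψ` with a purified state is the overlap of the
purification with `ψ ⊗ η` for a unit vector `η` of the environments (`PurifiedLE.fidelity_sq_le`),
and `‖ψ ⊗ η‖_q ≤ ‖ψ‖_q` (`schattenDualLE_kronecker`). The maximally entangled state of rank `k`
multiplies `‖φ‖_p ^ 2` by `k ^ θ` and `‖ψ‖_q ^ 2` by `k ^ (-θ)`, so that `k` cancels.
-/

section

open Matrix

/-! ### Operator monotonicity of powers -/

section OperatorMonotone
open scoped MatrixOrder Matrix.Norms.L2Operator NNReal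

/-- For an isometry `U`, the embedding `d ↦ U diag(d) Uᴴ` of the algebra of diagonal matrices. -/
noncomputable def isometryDiagonalHom {m ι : Type} [Fintype m] [Fintype ι] [DecidableEq m]
    [DecidableEq ι] (U : Matrix m ι ℂ) (hU : Uᴴ * U = 1) : (ι → ℂ) →⋆ₙₐ[ℂ] Matrix m m ℂ where
  toFun d := U * diagonal d * Uᴴ
  map_smul' c d := by
    simp [diagonal_smul]
  map_zero' := by simp
  map_add' c d := by
    rw [← Matrix.add_mul, ← Matrix.mul_add, diagonal_add]; rfl
  map_mul' c d := by
    calc U * diagonal (c * d) * Uᴴ = U * (diagonal c * diagonal d) * Uᴴ := by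
          rw [diagonal_mul_diagonal]; rfl
      _ = U * diagonal c * (1 : Matrix ι ι ℂ) * diagonal d * Uᴴ := by
          simp only [Matrix.mul_assoc, Matrix.one_mul]
      _ = _ := by rw [← hU]; simp only [Matrix.mul_assoc]
  map_star' d := by
    simp [star_eq_conjTranspose, conjTranspose_mul, Matrix.mul_assoc, diagonal_conjTranspose]

lemma isometry_diagonal_posSemidef {m ι : Type} [Fintype m] [Fintype ι]
    [DecidableEq ι] (U : Matrix m ι ℂ) {w : ι → ℝ} (hw : ∀ i, 0 ≤ w i) :
    (U * diagonal (fun i => (w i : ℂ)) * Uᴴ).PosSemidef :=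
  (PosSemidef.diagonal fun i => by simpa using hw i).mul_mul_conjTranspose_same U

lemma isometry_diagonal_nnrpow {m ι : Type} [Fintype m] [Fintype ι] [DecidableEq m]
    [DecidableEq ι] (U : Matrix m ι ℂ) (hU : Uᴴ * U = 1) (w : ι → ℝ≥0) {p : ℝ≥0} (hp : 0 < p) :
    (U * diagonal (fun i => ((w i : ℝ) : ℂ)) * Uᴴ) ^ p
      = U * diagonal (fun i => (((w i : ℝ) ^ (p : ℝ) : ℝ) : ℂ)) * Uᴴ := by
  have h0 : (0 : ι → ℂ) ≤ fun i => ((w i : ℝ) : ℂ) := fun i => by simp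
  have h1 : CFC.nnrpow (fun i => ((w i : ℝ) : ℂ)) p
      = fun i => (((w i : ℝ) ^ (p : ℝ) : ℝ) : ℂ) := by
    rw [CFC.nnrpow_map_pi (fun i => h0 i)]
    funext i
    rw [CFC.nnrpow_eq_rpow hp]
    exact CFC.rpow_algebraMap (A := ℂ) (x := w i) (y := (p : ℝ))
  have h2 : (0 : Matrix m m ℂ) ≤ isometryDiagonalHom U hU (fun i => ((w i : ℝ) : ℂ)) :=
    Matrix.nonneg_iff_posSemidef.2 (isometry_diagonal_posSemidef U fun i => (w i).2)
  have hc : Continuous (isometryDiagonalHom U hU) := by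
    change Continuous fun d : ι → ℂ => U * diagonal d * Uᴴ
    fun_prop
  have := NonUnitalStarAlgHom.map_cfcₙ (R := ℝ≥0) (isometryDiagonalHom U hU) (NNReal.nnrpow · p)
    (fun i => ((w i : ℝ) : ℂ)) (by fun_prop) (by simp [hp.ne']) hc h0 h2
  change isometryDiagonalHom U hU (CFC.nnrpow _ p) = CFC.nnrpow _ p at this
  rw [h1] at this
  exact this.symm

lemma quadratic_isometry_diagonal {m ι : Type} [Fintype m] [Fintype ι]
    [DecidableEq ι] (U : Matrix m ι ℂ) (w : ι → ℝ) (x : m → ℂ) :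
    star x ⬝ᵥ ((U * diagonal (fun i => (w i : ℂ)) * Uᴴ) *ᵥ x)
      = ((∑ i, w i * ‖(Uᴴ *ᵥ x) i‖ ^ 2 : ℝ) : ℂ) := by
  rw [← mulVec_mulVec, ← mulVec_mulVec, dotProduct_mulVec]
  have : star x ᵥ* U = star (Uᴴ *ᵥ x) := by rw [star_mulVec, conjTranspose_conjTranspose]
  rw [this]
  simp only [dotProduct, mulVec_diagonal, Pi.star_apply]
  push_cast
  refine Finset.sum_congr rfl fun i _ => ?_
  rw [← Complex.conj_mul']
  simp only [RCLike.star_def]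
  ring

/-- Operator monotonicity of `t ↦ t ^ θ`, `0 < θ ≤ 1`, for two positive operators that are given
by their spectral decompositions. -/
lemma sum_rpow_mul_le_of_sum_mul_le {m ι κ : Type} [Fintype m] [Fintype ι] [Fintype κ]
    [DecidableEq m] [DecidableEq ι] [DecidableEq κ] {θ : ℝ} (h0 : 0 < θ) (h1 : θ ≤ 1)
    {U : Matrix m ι ℂ} (hU : Uᴴ * U = 1) {V : Matrix m κ ℂ} (hV : Vᴴ * V = 1)
    {w : ι → ℝ} (hw : ∀ i, 0 ≤ w i) {z : κ → ℝ} (hz : ∀ i, 0 ≤ z i)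
    (h : ∀ x : m → ℂ, ∑ i, w i * ‖(Uᴴ *ᵥ x) i‖ ^ 2 ≤ ∑ i, z i * ‖(Vᴴ *ᵥ x) i‖ ^ 2)
    (x : m → ℂ) :
    ∑ i, w i ^ θ * ‖(Uᴴ *ᵥ x) i‖ ^ 2 ≤ ∑ i, z i ^ θ * ‖(Vᴴ *ᵥ x) i‖ ^ 2 := by
  lift w to ι → ℝ≥0 using hw
  lift z to κ → ℝ≥0 using hz
  lift θ to ℝ≥0 using h0.le
  have hle : U * diagonal (fun i => ((w i : ℝ) : ℂ)) * Uᴴ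
      ≤ V * diagonal (fun i => ((z i : ℝ) : ℂ)) * Vᴴ := by
    rw [Matrix.le_iff]
    refine PosSemidef.of_dotProduct_mulVec_nonneg ?_ fun y => ?_
    · exact (isometry_diagonal_posSemidef V fun i => (z i).2).isHermitian.sub
        (isometry_diagonal_posSemidef U fun i => (w i).2).isHermitian
    · rw [sub_mulVec, dotProduct_sub, quadratic_isometry_diagonal, quadratic_isometry_diagonal,
        ← Complex.ofReal_sub]
      exact_mod_cast sub_nonneg.2 (h y)
  have := CFC.nnrpow_le_nnrpow (p := θ) ⟨zero_le, by exact_mod_cast h1⟩ hle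
  rw [isometry_diagonal_nnrpow U hU w (by exact_mod_cast h0),
    isometry_diagonal_nnrpow V hV z (by exact_mod_cast h0), Matrix.le_iff] at this
  have h2 := this.dotProduct_mulVec_nonneg x
  rw [sub_mulVec, dotProduct_sub, quadratic_isometry_diagonal, quadratic_isometry_diagonal,
        ← Complex.ofReal_sub] at h2
  exact sub_nonneg.1 (by exact_mod_cast h2)
end OperatorMonotone

/-! ### Schatten norm bounds and their invariance -/

section SchattenBounds

variable {m n ι κ : Type} [Fintype m] [Fintype n] [Fintype ι] [Fintype κ]

lemma sum_norm_sq_conjTranspose_mulVec_le [DecidableEq ι] {V : Matrix m ι ℂ}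
    (hV : Vᴴ * V = 1) (x : m → ℂ) : ∑ i, ‖(Vᴴ *ᵥ x) i‖ ^ 2 ≤ ∑ a, ‖x a‖ ^ 2 := by
  classical
  have hP : ((1 - V * Vᴴ : Matrix m m ℂ)ᴴ * (1 - V * Vᴴ)) = 1 - V * Vᴴ := by
    have : V * Vᴴ * (V * Vᴴ) = V * Vᴴ := by
      rw [Matrix.mul_assoc, ← Matrix.mul_assoc Vᴴ, hV, Matrix.one_mul]
    simp [Matrix.mul_sub, Matrix.sub_mul, this]
  have h0 : (1 - V * Vᴴ : Matrix m m ℂ).PosSemidef := by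
    rw [← hP]; exact posSemidef_conjTranspose_mul_self _
  have h1 := h0.dotProduct_mulVec_nonneg x
  have h2 := quadratic_isometry_diagonal V (fun _ => 1) x
  have h3 := quadratic_isometry_diagonal (1 : Matrix m m ℂ) (fun _ => 1) x
  simp only [Complex.ofReal_one, diagonal_one, Matrix.mul_one, one_mul, conjTranspose_one,
    Matrix.one_mulVec] at h2 h3
  rw [sub_mulVec, dotProduct_sub, h2, Matrix.one_mulVec, h3, ← Complex.ofReal_sub] at h1
  exact sub_nonneg.1 (by exact_mod_cast h1)

lemma sum_norm_sq_mul_conjTranspose_le {k : Type} [DecidableEq m] {W : Matrix m n ℂ}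
    (hW : W * Wᴴ = 1) (Z : Matrix k n ℂ) (i : k) : ∑ c, ‖(Z * Wᴴ) i c‖ ^ 2 ≤ ∑ c, ‖Z i c‖ ^ 2 := by
  have h1 : (Wᵀ)ᴴ * Wᵀ = 1 := by
    rw [← transpose_one, ← hW, transpose_mul]; rfl
  have := sum_norm_sq_conjTranspose_mulVec_le h1 (Z i)
  refine le_trans (le_of_eq ?_) this
  refine Finset.sum_congr rfl fun c _ => ?_
  congr 2
  simp [Matrix.mul_apply, mulVec, dotProduct, mul_comm]

lemma exists_isometry_spectral [DecidableEq m] {H : Matrix m m ℂ} (hH : H.IsHermitian) :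
    ∃ V : Matrix m m ℂ, Vᴴ * V = 1 ∧ V * Vᴴ = 1 ∧
      H = V * diagonal (fun i => (hH.eigenvalues i : ℂ)) * Vᴴ := by
  refine ⟨hH.eigenvectorUnitary, ?_, ?_, ?_⟩
  · exact Unitary.coe_star_mul_self hH.eigenvectorUnitary
  · exact Unitary.coe_mul_star_self hH.eigenvectorUnitary
  · conv_lhs => rw [hH.spectral_theorem]
    rfl

/-- `SchattenDualLE θ Y G` says that `Tr (σ ^ θ * Y * Yᴴ) ≤ G` for all `σ ≥ 0` with `Tr σ ≤ 1`; the
operator `σ` is given by its spectral decomposition `U diag(w) Uᴴ`. For `0 < θ < 1` this is the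
bound `‖Y‖_q ^ 2 ≤ G` on the Schatten norm of exponent `q = 2 / (1 - θ)`, and for `θ = 1` the
same bound on the operator norm. -/
def SchattenDualLE (θ : ℝ) (Y : Matrix m n ℂ) (G : ℝ) : Prop :=
  ∀ (ι : Type) [Fintype ι] [DecidableEq ι] (U : Matrix m ι ℂ), Uᴴ * U = 1 →
    ∀ w : ι → ℝ, (∀ i, 0 ≤ w i) → ∑ i, w i ≤ 1 →
      ∑ i, w i ^ θ * ∑ c, ‖(Uᴴ * Y) i c‖ ^ 2 ≤ G

/-- `SchattenLE θ M C` is the bound `‖M‖_p ^ 2 ≤ C` on the Schatten norm of exponent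
`p = 2 / (1 + θ)`, stated through the duality of that norm with the one of `SchattenDualLE`. -/
def SchattenLE (θ : ℝ) (M : Matrix m n ℂ) (C : ℝ) : Prop :=
  ∀ (Y : Matrix m n ℂ) (G : ℝ), SchattenDualLE θ Y G → ‖(Yᴴ * M).trace‖ ^ 2 ≤ C * G

lemma SchattenDualLE.conjTranspose_isometry_mul {θ : ℝ} {G : ℝ} [DecidableEq m] {V : Matrix ι m ℂ}
    (hV : Vᴴ * V = 1) {Y : Matrix ι n ℂ} (h : SchattenDualLE θ Y G) :
    SchattenDualLE θ (Vᴴ * Y) G := by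
  intro κ _ _ U hU w hw hw1
  have := h κ (V * U) (by
    rw [conjTranspose_mul, Matrix.mul_assoc, ← Matrix.mul_assoc Vᴴ, hV, Matrix.one_mul, hU])
    w hw hw1
  rwa [conjTranspose_mul, Matrix.mul_assoc] at this

lemma SchattenLE.isometry_mul {θ : ℝ} {C : ℝ} [DecidableEq m] {V : Matrix ι m ℂ}
    (hV : Vᴴ * V = 1) {M : Matrix m n ℂ} (h : SchattenLE θ M C) : SchattenLE θ (V * M) C := by
  intro Y G hY
  have := h _ G (hY.conjTranspose_isometry_mul hV)
  rwa [conjTranspose_mul, conjTranspose_conjTranspose, Matrix.mul_assoc] at this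

lemma SchattenDualLE.mul_conjTranspose_coisometry {θ : ℝ} {G : ℝ} [DecidableEq n] {W : Matrix n ι ℂ}
    (hW : W * Wᴴ = 1) {Y : Matrix m ι ℂ} (h : SchattenDualLE θ Y G) :
    SchattenDualLE θ (Y * Wᴴ) G := by
  intro κ _ _ U hU w hw hw1
  refine le_trans (Finset.sum_le_sum fun i _ => ?_) (h κ U hU w hw hw1)
  rw [← Matrix.mul_assoc]
  exact mul_le_mul_of_nonneg_left (sum_norm_sq_mul_conjTranspose_le hW _ i)
    (Real.rpow_nonneg (hw i) _)

lemma SchattenLE.mul_coisometry {θ : ℝ} {C : ℝ} [DecidableEq n] {W : Matrix n ι ℂ}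
    (hW : W * Wᴴ = 1) {M : Matrix m n ℂ} (h : SchattenLE θ M C) : SchattenLE θ (M * W) C := by
  intro Y G hY
  have := h _ G (hY.mul_conjTranspose_coisometry hW)
  rwa [conjTranspose_mul, conjTranspose_conjTranspose, Matrix.mul_assoc, trace_mul_comm,
    Matrix.mul_assoc] at this

lemma SchattenLE.submatrix {m' n' : Type} [Fintype m'] [Fintype n'] {θ C : ℝ}
    {M : Matrix m n ℂ} (h : SchattenLE θ M C) (e : m' ≃ m) (f : n' ≃ n) :
    SchattenLE θ (M.submatrix e f) C := by
  intro Y G hY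
  have := h (Y.submatrix e.symm f.symm) G (by
    intro ι _ _ U hU w hw hw1
    have := hY ι (U.submatrix e id) (by
      rw [conjTranspose_submatrix, submatrix_mul_equiv, hU, submatrix_one _ Function.injective_id])
      w hw hw1
    refine le_trans (le_of_eq ?_) this
    refine Finset.sum_congr rfl fun i _ => ?_
    congr 1
    refine Fintype.sum_equiv f.symm _ _ fun c => ?_
    congr 2
    simp only [Matrix.mul_apply, conjTranspose_apply, submatrix_apply, id]
    exact Fintype.sum_equiv e.symm _ _ fun a => by simp)
  convert this using 3
  simp only [Matrix.trace, Matrix.diag, Matrix.mul_apply, conjTranspose_apply, submatrix_apply]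
  refine Fintype.sum_equiv f _ _ fun c => ?_
  exact Fintype.sum_equiv e _ _ fun a => by simp

end SchattenBounds

/-! ### Schatten norms and the transfer of a qubit -/

section QubitTransfer

variable {m n ι : Type} [Fintype m] [Fintype n] [Fintype ι]

/-- Moving a qubit from the column side to the row side of a matrix: the reshaping that the
transmission of a qubit from Bob to Alice induces on amplitudes. -/
def moveToRow (M : Matrix m (Fin 2 × n) ℂ) : Matrix (m × Fin 2) n ℂ :=
  Matrix.of fun x c => M x.1 (x.2, c)

/-- Moving a qubit from the row side to the column side of a matrix. -/
def moveToCol (M : Matrix (m × Fin 2) n ℂ) : Matrix m (Fin 2 × n) ℂ :=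
  Matrix.of fun a y => M (a, y.1) y.2

lemma trace_conjTranspose_mul_moveToRow (Y : Matrix (m × Fin 2) n ℂ)
    (M : Matrix m (Fin 2 × n) ℂ) :
    (Yᴴ * moveToRow M).trace = ((moveToCol Y)ᴴ * M).trace := by
  simp only [Matrix.trace, Matrix.diag, Matrix.mul_apply, conjTranspose_apply, moveToRow,
    moveToCol, Matrix.of_apply, Fintype.sum_prod_type]
  rw [Finset.sum_comm]
  simp_rw [Finset.sum_comm (s := (Finset.univ : Finset n))]
  rw [Finset.sum_comm]

lemma trace_conjTranspose_mul_moveToCol (Y : Matrix m (Fin 2 × n) ℂ)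
    (M : Matrix (m × Fin 2) n ℂ) :
    (Yᴴ * moveToCol M).trace = ((moveToRow Y)ᴴ * M).trace := by
  have := trace_conjTranspose_mul_moveToRow M Y
  have h := congrArg star this
  rw [← trace_conjTranspose, ← trace_conjTranspose] at h
  simpa [conjTranspose_mul] using h.symm

/-- `σ` on the rows of the smaller matrix is replaced by `σ ⊗ (1 / 2)` on the rows of the larger
one. -/
lemma SchattenDualLE.toCol [DecidableEq m] {θ G : ℝ} {Y : Matrix (m × Fin 2) n ℂ}
    (h : SchattenDualLE θ Y G) : SchattenDualLE θ (moveToCol Y) (2 ^ θ * G) := by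
  intro ι _ _ U hU w hw hw1
  have h2 := h (ι × Fin 2) (U ⊗ₖ (1 : Matrix (Fin 2) (Fin 2) ℂ)) (by
    rw [conjTranspose_kronecker, ← mul_kronecker_mul, hU, conjTranspose_one, Matrix.one_mul,
      one_kronecker_one]) (fun p => w p.1 / 2) (fun p => div_nonneg (hw _) two_pos.le) (by
    simpa [Fintype.sum_prod_type, ← Finset.sum_mul, mul_div_cancel₀] using hw1)
  have h3 : ∑ i, w i ^ θ * ∑ c, ‖(Uᴴ * moveToCol Y) i c‖ ^ 2
      = 2 ^ θ * ∑ p : ι × Fin 2, (w p.1 / 2) ^ θ *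
          ∑ c, ‖((U ⊗ₖ (1 : Matrix (Fin 2) (Fin 2) ℂ))ᴴ * Y) p c‖ ^ 2 := by
    rw [Fintype.sum_prod_type, Finset.mul_sum]
    refine Finset.sum_congr rfl fun i _ => ?_
    dsimp only
    rw [← Finset.mul_sum, Real.div_rpow (hw i) two_pos.le, ← mul_assoc,
      mul_div_cancel₀ _ (by positivity), Fintype.sum_prod_type]
    simp [Matrix.mul_apply, moveToCol, Fintype.sum_prod_type, Matrix.one_apply, apply_ite]
  rw [h3]
  exact mul_le_mul_of_nonneg_left h2 (by positivity)

/-- The operator inequality `σ ≤ 2 (Tr₂ σ) ⊗ 1`, as an inequality between quadratic forms. -/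
lemma quadratic_le_partialTraceB [DecidableEq m] [DecidableEq ι] (U : Matrix (m × Fin 2) ι ℂ)
    {w : ι → ℝ} (hw : ∀ i, 0 ≤ w i) {V : Matrix m m ℂ} {μ : m → ℝ}
    (hV : partialTraceB (U * diagonal (fun i => (w i : ℂ)) * Uᴴ)
      = V * diagonal (fun i => (μ i : ℂ)) * Vᴴ) (x : m × Fin 2 → ℂ) :
    ∑ i, w i * ‖(Uᴴ *ᵥ x) i‖ ^ 2
      ≤ ∑ p : m × Fin 2, (2 * μ p.1) *
          ‖((V ⊗ₖ (1 : Matrix (Fin 2) (Fin 2) ℂ))ᴴ *ᵥ x) p‖ ^ 2 := by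
  let E : Fin 2 → (m → ℂ) → m × Fin 2 → ℂ := fun τ y p => if p.2 = τ then y p.1 else 0
  let X : Fin 2 → m → ℂ := fun τ a => x (a, τ)
  have hx : x = E 0 (X 0) + E 1 (X 1) := by
    funext ⟨a, τ⟩
    fin_cases τ <;> simp [E, X]
  -- The left side is the quadratic form of `Tr₂ σ` at `y`, the right side the trace over the qubit.
  have hq : ∀ y : m → ℂ, ∑ j, μ j * ‖(Vᴴ *ᵥ y) j‖ ^ 2
      = ∑ τ, ∑ i, w i * ‖(Uᴴ *ᵥ E τ y) i‖ ^ 2 := by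
    intro y
    have h1 := quadratic_isometry_diagonal V μ y
    rw [← hV] at h1
    have h2 : ∀ τ, _ := fun τ => quadratic_isometry_diagonal U w (E τ y)
    have h3 : star y ⬝ᵥ (partialTraceB (U * diagonal (fun i => (w i : ℂ)) * Uᴴ) *ᵥ y)
        = ∑ τ, star (E τ y) ⬝ᵥ ((U * diagonal (fun i => (w i : ℂ)) * Uᴴ) *ᵥ E τ y) := by
      generalize U * diagonal (fun i => (w i : ℂ)) * Uᴴ = S
      simp [partialTraceB, dotProduct, mulVec, E, Fintype.sum_prod_type, add_mul, mul_add,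
        Finset.sum_add_distrib]
    simp only [h1, h2] at h3
    exact_mod_cast h3
  have hr : ∑ p : m × Fin 2, (2 * μ p.1) *
          ‖((V ⊗ₖ (1 : Matrix (Fin 2) (Fin 2) ℂ))ᴴ *ᵥ x) p‖ ^ 2
      = 2 * ∑ τ, ∑ j, μ j * ‖(Vᴴ *ᵥ X τ) j‖ ^ 2 := by
    rw [Fintype.sum_prod_type, Finset.sum_comm, Finset.mul_sum]
    refine Finset.sum_congr rfl fun τ _ => ?_
    rw [Finset.mul_sum]
    refine Finset.sum_congr rfl fun j _ => ?_
    rw [mul_assoc]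
    congr 4
    simp [mulVec, dotProduct, Fintype.sum_prod_type, X, Matrix.one_apply, apply_ite]
  rw [hr]
  simp only [hq, Fin.sum_univ_two, ← Finset.sum_add_distrib, Finset.mul_sum]
  refine Finset.sum_le_sum fun i _ => ?_
  have h4 : (Uᴴ *ᵥ x) i = (Uᴴ *ᵥ E 0 (X 0)) i + (Uᴴ *ᵥ E 1 (X 1)) i := by
    conv_lhs => rw [hx, mulVec_add]
    rfl
  -- The factor `2` is the dimension of the qubit: `|s + t|² ≤ 2 (|s|² + |t|²)`.
  have h5 : ‖(Uᴴ *ᵥ x) i‖ ^ 2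
      ≤ 2 * (‖(Uᴴ *ᵥ E 0 (X 0)) i‖ ^ 2 + ‖(Uᴴ *ᵥ E 1 (X 1)) i‖ ^ 2) := by
    rw [h4]
    have := norm_add_le ((Uᴴ *ᵥ E 0 (X 0)) i) ((Uᴴ *ᵥ E 1 (X 1)) i)
    nlinarith [sq_nonneg (‖(Uᴴ *ᵥ E 0 (X 0)) i‖ - ‖(Uᴴ *ᵥ E 1 (X 1)) i‖),
      norm_nonneg ((Uᴴ *ᵥ E 0 (X 0)) i + (Uᴴ *ᵥ E 1 (X 1)) i)]
  have h6 := mul_nonneg (hw i) (sq_nonneg ‖(Uᴴ *ᵥ E 1 (X 0)) i‖)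
  have h7 := mul_nonneg (hw i) (sq_nonneg ‖(Uᴴ *ᵥ E 0 (X 1)) i‖)
  have h8 := mul_le_mul_of_nonneg_left h5 (hw i)
  linarith

/-- Tracing the qubit out of `σ = U diag(w) Uᴴ` gives an operator `σ'` with `σ ≤ 2 (σ' ⊗ 1)`, and
operator monotonicity of the power `θ` turns the factor `2` into `2 ^ θ`. -/
lemma SchattenDualLE.toRow [DecidableEq m] {θ G : ℝ} (h0 : 0 < θ) (h1 : θ ≤ 1)
    {Y : Matrix m (Fin 2 × n) ℂ}
    (h : SchattenDualLE θ Y G) : SchattenDualLE θ (moveToRow Y) (2 ^ θ * G) := by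
  intro ι _ _ U hU w hw hw1
  set S := U * diagonal (fun i => (w i : ℂ)) * Uᴴ with hS
  have hSp : S.PosSemidef := isometry_diagonal_posSemidef U hw
  have hT : (partialTraceB S).PosSemidef := by
    have : partialTraceB S = ∑ τ : Fin 2, S.submatrix (fun a => (a, τ)) (fun a => (a, τ)) := by
      ext a b; simp [partialTraceB]
    rw [this]
    exact posSemidef_sum _ fun τ _ => hSp.submatrix _
  obtain ⟨V, hV, -, hVS⟩ := exists_isometry_spectral hT.isHermitian
  have hμ := hT.eigenvalues_nonneg
  have hμ1 : ∑ i, hT.isHermitian.eigenvalues i ≤ 1 := by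
    have e1 := hT.isHermitian.trace_eq_sum_eigenvalues
    have e2 : (partialTraceB S).trace = S.trace := by
      simp [partialTraceB, Matrix.trace, Fintype.sum_prod_type]
    have e3 : S.trace = ((∑ i, w i : ℝ) : ℂ) := by
      rw [hS, trace_mul_comm, ← Matrix.mul_assoc, hU, Matrix.one_mul, trace_diagonal]
      push_cast; rfl
    rw [e2, e3] at e1
    have e4 : ∑ i, w i = ∑ i, hT.isHermitian.eigenvalues i := by
      apply Complex.ofReal_injective
      rw [e1]
      push_cast
      rfl
    rwa [← e4]
  set μ := hT.isHermitian.eigenvalues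
  have hV2 : (V ⊗ₖ (1 : Matrix (Fin 2) (Fin 2) ℂ))ᴴ *
      (V ⊗ₖ (1 : Matrix (Fin 2) (Fin 2) ℂ)) = 1 := by
    rw [conjTranspose_kronecker, ← mul_kronecker_mul, hV, conjTranspose_one, Matrix.one_mul,
      one_kronecker_one]
  have hmono := sum_rpow_mul_le_of_sum_mul_le h0 h1 hU hV2 hw
    (z := fun p => 2 * μ p.1) (fun p => mul_nonneg two_pos.le (hμ p.1))
    (quadratic_le_partialTraceB U hw hVS)
  have h2 := h m V hV μ hμ hμ1
  calc ∑ i, w i ^ θ * ∑ c, ‖(Uᴴ * moveToRow Y) i c‖ ^ 2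
      = ∑ c, ∑ i, w i ^ θ * ‖(Uᴴ *ᵥ fun x => moveToRow Y x c) i‖ ^ 2 := by
        rw [Finset.sum_comm]
        simp_rw [Finset.mul_sum]
        rfl
    _ ≤ ∑ c, ∑ p : m × Fin 2, (2 * μ p.1) ^ θ * ‖((V ⊗ₖ (1 : Matrix (Fin 2) (Fin 2) ℂ))ᴴ *ᵥ
          fun x => moveToRow Y x c) p‖ ^ 2 := Finset.sum_le_sum fun c _ => hmono _
    _ = 2 ^ θ * ∑ j, μ j ^ θ * ∑ c, ‖(Vᴴ * Y) j c‖ ^ 2 := by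
        rw [Finset.sum_comm, Fintype.sum_prod_type, Finset.mul_sum]
        refine Finset.sum_congr rfl fun j _ => ?_
        rw [Fintype.sum_prod_type, Finset.mul_sum, Finset.mul_sum]
        refine Finset.sum_congr rfl fun τ _ => ?_
        rw [Finset.mul_sum, Finset.mul_sum]
        refine Finset.sum_congr rfl fun c _ => ?_
        rw [Real.mul_rpow two_pos.le (hμ j), mul_assoc]
        congr 4
        simp [mulVec, dotProduct, Fintype.sum_prod_type, Matrix.one_apply, apply_ite,
          moveToRow, Matrix.mul_apply]
    _ ≤ 2 ^ θ * G := mul_le_mul_of_nonneg_left h2 (by positivity)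

lemma SchattenLE.toRow [DecidableEq m] {θ C : ℝ} {M : Matrix m (Fin 2 × n) ℂ}
    (h : SchattenLE θ M C) : SchattenLE θ (moveToRow M) (2 ^ θ * C) := by
  intro Y G hY
  rw [trace_conjTranspose_mul_moveToRow]
  exact (h _ _ hY.toCol).trans_eq (by ring)

lemma SchattenLE.toCol [DecidableEq m] {θ C : ℝ} (h0 : 0 < θ) (h1 : θ ≤ 1)
    {M : Matrix (m × Fin 2) n ℂ}
    (h : SchattenLE θ M C) : SchattenLE θ (moveToCol M) (2 ^ θ * C) := by
  intro Y G hY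
  rw [trace_conjTranspose_mul_moveToCol]
  exact (h _ _ (hY.toRow h0 h1)).trans_eq (by ring)

end QubitTransfer

/-! ### Schatten norm bounds from the spectrum -/

section SpectralBounds

/-- Jensen's inequality for the concave function `t ↦ t ^ θ` with weights of total mass at most
one. -/
lemma sum_rpow_mul_le_rpow_sum_mul {ι : Type} [Fintype ι] {θ : ℝ} (h0 : 0 < θ) (h1 : θ ≤ 1)
    {w D : ι → ℝ} (hw : ∀ i, 0 ≤ w i) (hD : ∀ i, 0 ≤ D i) (hD1 : ∑ i, D i ≤ 1) :
    ∑ i, w i ^ θ * D i ≤ (∑ i, w i * D i) ^ θ := by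
  have h := Real.inner_le_weight_mul_Lp_of_nonneg Finset.univ (p := θ⁻¹)
    ((one_le_inv₀ h0).2 h1) D (fun i => w i ^ θ) hD (fun i => Real.rpow_nonneg (hw i) _)
  have h2 : ∀ i, (w i ^ θ) ^ θ⁻¹ = w i := fun i => Real.rpow_rpow_inv (hw i) h0.ne'
  simp only [h2, inv_inv] at h
  calc ∑ i, w i ^ θ * D i = ∑ i, D i * w i ^ θ := by simp only [mul_comm]
    _ ≤ (∑ i, D i) ^ (1 - θ) * (∑ i, D i * w i) ^ θ := h
    _ ≤ 1 * (∑ i, D i * w i) ^ θ := by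
        refine mul_le_mul_of_nonneg_right ?_ (Real.rpow_nonneg
          (Finset.sum_nonneg fun i _ => mul_nonneg (hD i) (hw i)) _)
        exact Real.rpow_le_one (Finset.sum_nonneg fun i _ => hD i) hD1 (by linarith)
    _ = _ := by simp only [one_mul, mul_comm]

/-- `HolderLE θ l G` says that `∑ s_k ^ θ * l_k ≤ G` for all sub-probability vectors `s`, that is
`‖l‖_{1 / (1 - θ)} ≤ G`: the commutative counterpart of `SchattenDualLE`. -/
def HolderLE {κ : Type} [Fintype κ] (θ : ℝ) (l : κ → ℝ) (G : ℝ) : Prop :=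
  ∀ s : κ → ℝ, (∀ k, 0 ≤ s k) → ∑ k, s k ≤ 1 → ∑ k, s k ^ θ * l k ≤ G

/-- Spreading each entry evenly over `k` copies divides the norm of exponent `1 / (1 - θ)` by
`k ^ θ`. -/
lemma HolderLE.prod_const {κ : Type} [Fintype κ] {θ : ℝ} (h0 : 0 < θ) (h1 : θ ≤ 1) {l : κ → ℝ}
    (hl : ∀ i, 0 ≤ l i) {G : ℝ} (h : HolderLE θ l G) {k : ℕ} (hk : 0 < k) :
    HolderLE θ (fun p : κ × Fin k => l p.1 / k) (G / k ^ θ) := by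
  intro s hs hs1
  have hk' : (0 : ℝ) < k := by exact_mod_cast hk
  have h2 := h (fun i => ∑ j : Fin k, s (i, j)) (fun i => Finset.sum_nonneg fun j _ => hs _)
    (by rwa [← Fintype.sum_prod_type'])
  rw [Fintype.sum_prod_type, le_div_iff₀ (by positivity), Finset.sum_mul]
  refine le_trans (Finset.sum_le_sum fun i _ => ?_) h2
  have h3 := sum_rpow_mul_le_rpow_sum_mul h0 h1 (w := fun j => s (i, j))
    (D := fun _ : Fin k => 1 / (k : ℝ)) (fun j => hs _) (fun _ => by positivity)
    (by simp [hk'.ne'])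
  rw [← Finset.sum_mul, ← Finset.sum_mul, mul_one_div, mul_one_div,
    Real.div_rpow (Finset.sum_nonneg fun j _ => hs _) hk'.le, le_div_iff₀ (by positivity)] at h3
  calc (∑ j : Fin k, s (i, j) ^ θ * (l i / k)) * (k : ℝ) ^ θ
      = ((∑ j : Fin k, s (i, j) ^ θ) / k * (k : ℝ) ^ θ) * l i := by
        rw [← Finset.sum_mul]; ring
    _ ≤ _ := mul_le_mul_of_nonneg_right h3 (hl i)

lemma sq_sum_mul_le {ι : Type} [Fintype ι] (f g : ι → ℂ) :
    ‖∑ i, f i * g i‖ ^ 2 ≤ (∑ i, ‖f i‖ ^ 2) * ∑ i, ‖g i‖ ^ 2 := by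
  have h1 : ‖∑ i, f i * g i‖ ≤ ∑ i, ‖f i‖ * ‖g i‖ :=
    (norm_sum_le _ _).trans_eq (by simp)
  refine (pow_le_pow_left₀ (norm_nonneg _) h1 2).trans ?_
  exact Finset.sum_mul_sq_le_sq_mul_sq _ _ _

/-- A matrix with singular values `√l_i` has Schatten norm of exponent `2α` at most
`(∑ l_i ^ α) ^ (1 / (2α))`: Hölder's inequality for the pairing with a second matrix. -/
lemma schattenLE_of_singularValues {m n κ : Type} [Fintype m] [Fintype n] [Fintype κ]
    [DecidableEq m] [DecidableEq κ] {α : ℝ} (hα : 0 < α) {M : Matrix m n ℂ}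
    {V : Matrix m κ ℂ} (hV : Vᴴ * V = 1) (hV' : V * Vᴴ = 1) {l : κ → ℝ}
    (hM : M * Mᴴ = V * diagonal (fun i => (l i : ℂ)) * Vᴴ) :
    SchattenLE (1 / α - 1) M ((∑ i, l i ^ α) ^ (1 / α)) := by
  intro Y G hY
  have hl : ∀ i, ∑ c, ‖(Vᴴ * M) i c‖ ^ 2 = l i := by
    intro i
    have e : (Vᴴ * M) * (Vᴴ * M)ᴴ = diagonal (fun i => (l i : ℂ)) := by
      rw [conjTranspose_mul, conjTranspose_conjTranspose, Matrix.mul_assoc, ← Matrix.mul_assoc M,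
        hM, ← Matrix.mul_assoc, ← Matrix.mul_assoc, ← Matrix.mul_assoc, hV, Matrix.one_mul,
        Matrix.mul_assoc, hV, Matrix.mul_one]
    have e2 := congrFun (congrFun e i) i
    rw [Matrix.mul_apply, diagonal_apply_eq] at e2
    simp only [conjTranspose_apply, RCLike.star_def, Complex.mul_conj'] at e2
    exact_mod_cast e2
  have hl0 : ∀ i, 0 ≤ l i := fun i => by rw [← hl]; positivity
  set Z := ∑ i, l i ^ α with hZ
  have hZ0 : 0 ≤ Z := Finset.sum_nonneg fun i _ => Real.rpow_nonneg (hl0 i) _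
  have ht : (Yᴴ * M).trace = ∑ i, ∑ c, star ((Vᴴ * Y) i c) * (Vᴴ * M) i c := by
    have : Yᴴ * M = (Vᴴ * Y)ᴴ * (Vᴴ * M) := by
      rw [conjTranspose_mul, conjTranspose_conjTranspose, Matrix.mul_assoc, ← Matrix.mul_assoc V,
        hV', Matrix.one_mul]
    rw [this]
    generalize Vᴴ * Y = P
    generalize Vᴴ * M = Q
    simp only [Matrix.trace, Matrix.diag, Matrix.mul_apply, conjTranspose_apply]
    rw [Finset.sum_comm]
  set y : κ → ℝ := fun i => ∑ c, ‖(Vᴴ * Y) i c‖ ^ 2 with hy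
  have hy0 : ∀ i, 0 ≤ y i := fun i => by positivity
  -- Rows are estimated by Cauchy–Schwarz, and then `√l_i` is split as
  -- `l_i ^ (α / 2) * l_i ^ ((1 - α) / 2)`.
  have h1 : ‖(Yᴴ * M).trace‖ ≤ ∑ i, √(l i ^ α) * √(l i ^ (1 - α) * y i) := by
    rw [ht]
    refine (norm_sum_le _ _).trans (Finset.sum_le_sum fun i _ => ?_)
    rw [← Real.sqrt_mul (Real.rpow_nonneg (hl0 i) _), ← mul_assoc]
    refine Real.le_sqrt_of_sq_le ((sq_sum_mul_le _ _).trans_eq ?_)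
    rw [hl i, ← Real.rpow_add' (hl0 i) (by norm_num)]
    simp [hy, mul_comm]
  have h2 : ‖(Yᴴ * M).trace‖ ^ 2 ≤ Z * ∑ i, l i ^ (1 - α) * y i := by
    refine (pow_le_pow_left₀ (norm_nonneg _) h1 2).trans
      ((Finset.sum_mul_sq_le_sq_mul_sq _ _ _).trans_eq ?_)
    congr 1
    · exact Finset.sum_congr rfl fun i _ => Real.sq_sqrt (Real.rpow_nonneg (hl0 i) _)
    · exact Finset.sum_congr rfl fun i _ =>
        Real.sq_sqrt (mul_nonneg (Real.rpow_nonneg (hl0 i) _) (hy0 i))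
  rcases hZ0.eq_or_lt with hZ1 | hZ1
  · rw [← hZ1, zero_mul] at h2
    rw [← hZ1, Real.zero_rpow (by positivity), zero_mul]
    exact h2
  refine h2.trans ?_
  -- The optimal `σ` has the eigenvalues `l_i ^ α / Z`.
  have h3 := hY κ V hV (fun i => l i ^ α / Z)
    (fun i => div_nonneg (Real.rpow_nonneg (hl0 i) _) hZ0)
    (by rw [← Finset.sum_div, div_self hZ1.ne'])
  have h4 : ∀ i, (l i ^ α / Z) ^ (1 / α - 1) = l i ^ (1 - α) / Z ^ (1 / α - 1) := by
    intro i
    rw [Real.div_rpow (Real.rpow_nonneg (hl0 i) _) hZ0, ← Real.rpow_mul (hl0 i)]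
    congr 2
    field_simp
  simp only [h4, div_mul_eq_mul_div, ← Finset.sum_div] at h3
  rw [div_le_iff₀ (by positivity)] at h3
  calc Z * ∑ i, l i ^ (1 - α) * y i ≤ Z * (G * Z ^ (1 / α - 1)) :=
        mul_le_mul_of_nonneg_left h3 hZ0
    _ = (Z ^ (1 / α - 1) * Z) * G := by ring
    _ = Z ^ (1 / α) * G := by
        nth_rewrite 2 [← Real.rpow_one Z]
        rw [← Real.rpow_add hZ1]
        congr 2
        ring

/-- The Schatten norm of exponent at least `2` of a tensor product with a matrix of
Hilbert–Schmidt norm one is at most that of the first factor. The squared overlaps `D` of the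
eigenvectors of `σ` with `v_k ⊗ η_j`, summed over the columns `η_j` of `η`, form a doubly
substochastic matrix, which reduces the claim to the commutative case. -/
lemma schattenDualLE_kronecker {a b κ I J : Type} [Fintype a] [Fintype b] [Fintype κ]
    [Fintype I] [Fintype J] [DecidableEq κ] {θ : ℝ} (h0 : 0 < θ) (h1 : θ ≤ 1)
    {Ψ : Matrix a b ℂ} {V : Matrix a κ ℂ} (hV : Vᴴ * V = 1) {l : κ → ℝ} (hl : ∀ k, 0 ≤ l k)
    (hΨΨ : Ψ * Ψᴴ = V * diagonal (fun k => (l k : ℂ)) * Vᴴ)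
    {η : Matrix I J ℂ} (hη : ∑ i, ∑ j, ‖η i j‖ ^ 2 = 1) {G : ℝ} (hG : HolderLE θ l G) :
    SchattenDualLE θ (Ψ ⊗ₖ η) G := by
  intro ι _ _ U hU w hw hw1
  classical
  have hΨ : ∀ g : a → ℂ, ∑ c, ‖(Ψᴴ *ᵥ g) c‖ ^ 2 = ∑ k, l k * ‖(Vᴴ *ᵥ g) k‖ ^ 2 := by
    intro g
    have e1 := quadratic_isometry_diagonal V l g
    have e2 := quadratic_isometry_diagonal Ψ (fun _ => 1) g
    simp only [Complex.ofReal_one, diagonal_one, Matrix.mul_one, one_mul] at e2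
    rw [← hΨΨ, e2] at e1
    exact_mod_cast e1
  let h : ι → J → a → ℂ := fun x j p => ∑ i, star (η i j) * U (p, i) x
  let D : ι → κ → ℝ := fun x k => ∑ j, ‖(Vᴴ *ᵥ h x j) k‖ ^ 2
  have hD : ∀ x k, 0 ≤ D x k := fun x k => by positivity
  have hUU : ∀ x, ∑ p, ∑ i, ‖U (p, i) x‖ ^ 2 = 1 := by
    intro x
    have := congrFun (congrFun hU x) x
    simp only [Matrix.mul_apply, conjTranspose_apply, Matrix.one_apply_eq,
      Fintype.sum_prod_type, RCLike.star_def, Complex.conj_mul'] at this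
    exact_mod_cast this
  have hVV : ∀ k, ∑ p, ‖V p k‖ ^ 2 = 1 := by
    intro k
    have := congrFun (congrFun hV k) k
    simp only [Matrix.mul_apply, conjTranspose_apply, Matrix.one_apply_eq,
      RCLike.star_def, Complex.conj_mul'] at this
    exact_mod_cast this
  have hDk : ∀ x, ∑ k, D x k ≤ 1 := by
    intro x
    calc ∑ k, D x k = ∑ j, ∑ k, ‖(Vᴴ *ᵥ h x j) k‖ ^ 2 := Finset.sum_comm
      _ ≤ ∑ j, ∑ p, ‖h x j p‖ ^ 2 :=
          Finset.sum_le_sum fun j _ => sum_norm_sq_conjTranspose_mulVec_le hV _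
      _ ≤ ∑ j, ∑ p, (∑ i, ‖star (η i j)‖ ^ 2) * ∑ i, ‖U (p, i) x‖ ^ 2 :=
          Finset.sum_le_sum fun j _ => Finset.sum_le_sum fun p _ => sq_sum_mul_le _ _
      _ = 1 := by
          simp only [← Finset.mul_sum, hUU, mul_one, norm_star]
          rw [Finset.sum_comm, hη]
  have hDx : ∀ k, ∑ x, D x k ≤ 1 := by
    intro k
    have e : ∀ x j, ‖(Vᴴ *ᵥ h x j) k‖ = ‖(Uᴴ *ᵥ fun p => V p.1 k * η p.2 j) x‖ := by
      intro x j
      rw [← norm_star]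
      congr 1
      simp only [h, mulVec, dotProduct, conjTranspose_apply, star_sum, star_mul', star_star,
        Fintype.sum_prod_type, Finset.mul_sum]
      exact Finset.sum_congr rfl fun p _ => Finset.sum_congr rfl fun i _ => by ring
    calc ∑ x, D x k = ∑ j, ∑ x, ‖(Uᴴ *ᵥ fun p => V p.1 k * η p.2 j) x‖ ^ 2 := by
          simp only [D, e]; exact Finset.sum_comm
      _ ≤ ∑ j, ∑ p : a × I, ‖V p.1 k * η p.2 j‖ ^ 2 :=
          Finset.sum_le_sum fun j _ => sum_norm_sq_conjTranspose_mulVec_le hU _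
      _ = 1 := by
          simp only [norm_mul, mul_pow, Fintype.sum_prod_type, ← Finset.mul_sum,
            ← Finset.sum_mul, hVV, one_mul]
          rw [Finset.sum_comm, hη]
  have hsum : ∀ x, ∑ c, ‖(Uᴴ * (Ψ ⊗ₖ η)) x c‖ ^ 2 = ∑ k, l k * D x k := by
    intro x
    have e : ∀ c j, ‖(Uᴴ * (Ψ ⊗ₖ η)) x (c, j)‖ = ‖(Ψᴴ *ᵥ h x j) c‖ := by
      intro c j
      rw [← norm_star]
      congr 1
      simp only [h, mulVec, dotProduct, Matrix.mul_apply, conjTranspose_apply, star_sum, star_mul',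
        star_star, Fintype.sum_prod_type, Finset.mul_sum, kroneckerMap_apply]
      exact Finset.sum_congr rfl fun p _ => Finset.sum_congr rfl fun i _ => by ring
    rw [Fintype.sum_prod_type, Finset.sum_comm]
    simp only [e, hΨ, D, Finset.mul_sum]
    exact Finset.sum_comm
  have hs := hG (fun k => ∑ x, w x * D x k)
    (fun k => Finset.sum_nonneg fun x _ => mul_nonneg (hw x) (hD x k)) (by
      rw [Finset.sum_comm]
      refine le_trans (Finset.sum_le_sum fun x _ => ?_) hw1
      rw [← Finset.mul_sum]
      exact mul_le_of_le_one_right (hw x) (hDk x))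
  refine le_trans ?_ hs
  calc ∑ x, w x ^ θ * ∑ c, ‖(Uᴴ * (Ψ ⊗ₖ η)) x c‖ ^ 2
      = ∑ k, (∑ x, w x ^ θ * D x k) * l k := by
        simp only [hsum, Finset.mul_sum, Finset.sum_mul]
        rw [Finset.sum_comm]
        exact Finset.sum_congr rfl fun k _ => Finset.sum_congr rfl fun x _ => by ring
    _ ≤ ∑ k, (∑ x, w x * D x k) ^ θ * l k :=
        Finset.sum_le_sum fun k _ => mul_le_mul_of_nonneg_right
          (sum_rpow_mul_le_rpow_sum_mul h0 h1 hw (fun x => hD x k) (hDx k)) (hl k)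

end SpectralBounds

/-! ### Fidelity with a pure state -/

section PureFidelity

variable {X : Type} [Fintype X] [DecidableEq X]

lemma cfc_sqrt_smul_of_isIdempotentElem {P : Matrix X X ℂ} (hP : IsSelfAdjoint P)
    (hPP : IsIdempotentElem P) (c : ℝ) : cfc Real.sqrt (c • P) = √c • P := by
  rw [← cfc_comp_const_mul c Real.sqrt P]
  have h : cfc (fun x => √(c * x)) P = cfc (fun x => √c * x) P := by
    refine cfc_congr fun x hx => ?_
    rcases hPP.spectrum_subset ℝ hx with h | h <;> subst h <;> simp
  rw [h, cfc_const_mul_id _ _ hP]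

lemma fidelity_vecMulVec {v : X → ℂ} (hv : ∑ x, ‖v x‖ ^ 2 = 1) {σ : Matrix X X ℂ} {c : ℝ}
    (hσ : star v ⬝ᵥ (σ *ᵥ v) = c) :
    fidelity (vecMulVec v (star v)) σ = √c := by
  have hvv : star v ⬝ᵥ v = 1 := by
    simp only [dotProduct, Pi.star_apply, RCLike.star_def, Complex.conj_mul']
    exact_mod_cast hv
  have hP : IsSelfAdjoint (vecMulVec v (star v)) :=
    (posSemidef_vecMulVec_self_star v).isHermitian
  have hPP : IsIdempotentElem (vecMulVec v (star v)) := by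
    rw [IsIdempotentElem, vecMulVec_mul_vecMulVec, hvv, one_smul]
  have h1 : cfc Real.sqrt (vecMulVec v (star v)) = vecMulVec v (star v) := by
    have := cfc_sqrt_smul_of_isIdempotentElem hP hPP 1
    simpa using this
  have h2 : vecMulVec v (star v) * σ * vecMulVec v (star v) = c • vecMulVec v (star v) := by
    rw [vecMulVec_mul, vecMulVec_mul_vecMulVec, ← dotProduct_mulVec, hσ]
    ext i j
    simp [vecMulVec_apply, mul_left_comm]
  rw [fidelity, h1, h2, cfc_sqrt_smul_of_isIdempotentElem hP hPP c, trace_smul, trace_vecMulVec,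
    dotProduct_comm, hvv]
  simp

end PureFidelity

/-! ### Purified states and protocols -/

section Purification

variable {A B I J : Type}

/-- The amplitude vector on `A × B` that belongs to the basis vectors `i`, `j` of the
environments. -/
def slice (M : Matrix (A × I) (B × J) ℂ) (i : I) (j : J) : A × B → ℂ :=
  fun x => M (x.1, i) (x.2, j)

/-- The Stinespring isometry `A → A' ⊗ (I ⊗ Fin r)` of a quantum channel, next to a spectator
`I`. -/
def stinespring {A' : Type} {r : ℕ} [DecidableEq I] (K : Fin r → Matrix A' A ℂ) :
    Matrix (A' × (I × Fin r)) (A × I) ℂ :=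
  Matrix.of fun x y => if x.2.1 = y.2 then K x.2.2 x.1 y.1 else 0

lemma stinespring_isometry {A' : Type} [Fintype A'] [Fintype I] [DecidableEq A] [DecidableEq I] {r : ℕ}
    {K : Fin r → Matrix A' A ℂ} (hK : ∑ i, (K i).conjTranspose * K i = 1) :
    (stinespring (I := I) K)ᴴ * stinespring (I := I) K = 1 := by
  ext ⟨a, i⟩ ⟨b, j⟩
  have h := congrFun (congrFun hK a) b
  simp only [Matrix.sum_apply, Matrix.mul_apply, conjTranspose_apply] at h
  simp only [Matrix.mul_apply, conjTranspose_apply, stinespring, Matrix.of_apply,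
    Fintype.sum_prod_type, apply_ite star, star_zero, ite_mul, zero_mul, mul_ite, mul_zero]
  rw [Finset.sum_comm]
  by_cases hij : i = j
  · subst hij
    have : ∀ x : I, (∑ y : A', ∑ l : Fin r, if x = i then
        (if x = i then star (K l y a) * K l y b else 0) else 0)
        = if x = i then ∑ l, ∑ y, star (K l y a) * K l y b else 0 := by
      intro x
      split_ifs
      · exact Finset.sum_comm
      · simp
    simp only [this, Finset.sum_ite_eq', Finset.mem_univ, if_true, h]
    simp [Matrix.one_apply]
  · have h1 : (1 : Matrix (A × I) (A × I) ℂ) (a, i) (b, j) = 0 := by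
      rw [Matrix.one_apply_ne]; simp [hij]
    rw [h1]
    refine Finset.sum_eq_zero fun x _ => Finset.sum_eq_zero fun y _ =>
      Finset.sum_eq_zero fun l _ => ?_
    split_ifs with h2 h3 <;> first | rfl | exact absurd (h3.symm.trans h2) hij

variable [Fintype A] [Fintype B] [Fintype I] [Fintype J]

/-- `PurifiedLE θ C ρ` says that `ρ` is the reduced state of a vector of `(A I) ⊗ (B J)`, the
environments `I` and `J` being held by Alice and by Bob, whose amplitude matrix `M` satisfies
`SchattenLE θ M C`. -/
def PurifiedLE (θ C : ℝ) (ρ : Matrix (A × B) (A × B) ℂ) : Prop :=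
  ∃ (I J : Type) (_ : Fintype I) (_ : Fintype J) (M : Matrix (A × I) (B × J) ℂ),
    ρ = ∑ i, ∑ j, vecMulVec (slice M i j) (star (slice M i j)) ∧ SchattenLE θ M C

lemma mul_vecMulVec_star_mul {X Y : Type} [Fintype X] [Fintype Y] (L : Matrix Y X ℂ) (v : X → ℂ) :
    L * vecMulVec v (star v) * Lᴴ = vecMulVec (L *ᵥ v) (star (L *ᵥ v)) := by
  rw [mul_vecMulVec, vecMulVec_mul, star_mulVec]

lemma PurifiedLE.localA {A' : Type} [Fintype A'] [DecidableEq A] [DecidableEq B] {r : ℕ}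
    {θ C : ℝ} {ρ : Matrix (A × B) (A × B) ℂ} (h : PurifiedLE θ C ρ) {K : Fin r → Matrix A' A ℂ}
    (hK : ∑ i, (K i).conjTranspose * K i = 1) :
    PurifiedLE θ C
      (∑ i, (K i ⊗ₖ (1 : Matrix B B ℂ)) * ρ * (K i ⊗ₖ (1 : Matrix B B ℂ)).conjTranspose) := by
  classical
  obtain ⟨I, J, _, _, M, rfl, hM⟩ := h
  refine ⟨I × Fin r, J, inferInstance, inferInstance, stinespring (I := I) K * M, ?_,
    hM.isometry_mul (stinespring_isometry hK)⟩
  have hs : ∀ i l j, slice (stinespring (I := I) K * M) (i, l) j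
      = (K l ⊗ₖ (1 : Matrix B B ℂ)) *ᵥ slice M i j := by
    intro i l j
    funext ⟨a, b⟩
    change (stinespring (I := I) K * M) (a, (i, l)) (b, j) = _
    rw [Matrix.mul_apply]
    simp [slice, stinespring, mulVec, dotProduct, Fintype.sum_prod_type, Matrix.one_apply]
  simp only [Fintype.sum_prod_type, hs, Matrix.mul_sum, Matrix.sum_mul, mul_vecMulVec_star_mul]
  exact Finset.sum_comm

lemma PurifiedLE.localB {B' : Type} [Fintype B'] [DecidableEq A] [DecidableEq B] {r : ℕ}
    {θ C : ℝ} {ρ : Matrix (A × B) (A × B) ℂ} (h : PurifiedLE θ C ρ) {K : Fin r → Matrix B' B ℂ}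
    (hK : ∑ i, (K i).conjTranspose * K i = 1) :
    PurifiedLE θ C
      (∑ i, ((1 : Matrix A A ℂ) ⊗ₖ K i) * ρ * ((1 : Matrix A A ℂ) ⊗ₖ K i).conjTranspose) := by
  classical
  obtain ⟨I, J, _, _, M, rfl, hM⟩ := h
  have hW : (stinespring (I := J) K)ᵀ * ((stinespring (I := J) K)ᵀ)ᴴ = 1 := by
    rw [← transpose_one, ← stinespring_isometry (I := J) hK, transpose_mul]; rfl
  refine ⟨I, J × Fin r, inferInstance, inferInstance, M * (stinespring (I := J) K)ᵀ, ?_,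
    hM.mul_coisometry hW⟩
  have hs : ∀ i j l, slice (M * (stinespring (I := J) K)ᵀ) i (j, l)
      = ((1 : Matrix A A ℂ) ⊗ₖ K l) *ᵥ slice M i j := by
    intro i j l
    funext ⟨a, b⟩
    change (M * (stinespring (I := J) K)ᵀ) (a, i) (b, (j, l)) = _
    rw [Matrix.mul_apply]
    simp [slice, stinespring, mulVec, dotProduct, Fintype.sum_prod_type, Matrix.one_apply,
      mul_comm]
  simp only [Fintype.sum_prod_type, hs, Matrix.mul_sum, Matrix.sum_mul, mul_vecMulVec_star_mul]
  rw [Finset.sum_comm]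
  refine Finset.sum_congr rfl fun i _ => ?_
  rw [Finset.sum_comm]

lemma PurifiedLE.qubitAB {θ C : ℝ} (h0 : 0 < θ) (h1 : θ ≤ 1)
    {ρ : Matrix ((A × Fin 2) × B) ((A × Fin 2) × B) ℂ} (h : PurifiedLE θ C ρ) :
    PurifiedLE θ (2 ^ θ * C) (ρ.submatrix (Equiv.prodAssoc A (Fin 2) B).symm
      (Equiv.prodAssoc A (Fin 2) B).symm) := by
  classical
  obtain ⟨I, J, _, _, M, rfl, hM⟩ := h
  let e : (A × I) × Fin 2 ≃ (A × Fin 2) × I :=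
    ⟨fun x => ((x.1.1, x.2), x.1.2), fun x => ((x.1.1, x.2), x.1.2), fun _ => rfl, fun _ => rfl⟩
  refine ⟨I, J, inferInstance, inferInstance,
    (moveToCol (M.submatrix e (Equiv.refl _))).submatrix (Equiv.refl _)
      (Equiv.prodAssoc (Fin 2) B J), ?_,
    ((hM.submatrix e (Equiv.refl _)).toCol h0 h1).submatrix _ _⟩
  ext x y
  simp only [submatrix_apply, Matrix.sum_apply]
  rfl

lemma PurifiedLE.qubitBA {θ C : ℝ}
    {ρ : Matrix (A × (Fin 2 × B)) (A × (Fin 2 × B)) ℂ} (h : PurifiedLE θ C ρ) :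
    PurifiedLE θ (2 ^ θ * C) (ρ.submatrix (Equiv.prodAssoc A (Fin 2) B)
      (Equiv.prodAssoc A (Fin 2) B)) := by
  classical
  obtain ⟨I, J, _, _, M, rfl, hM⟩ := h
  let e : (A × Fin 2) × I ≃ (A × I) × Fin 2 :=
    ⟨fun x => ((x.1.1, x.2), x.1.2), fun x => ((x.1.1, x.2), x.1.2), fun _ => rfl, fun _ => rfl⟩
  refine ⟨I, J, inferInstance, inferInstance,
    (moveToRow (M.submatrix (Equiv.refl _) (Equiv.prodAssoc (Fin 2) B J).symm)).submatrix e
      (Equiv.refl _), ?_,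
    ((hM.submatrix (Equiv.refl _) (Equiv.prodAssoc (Fin 2) B J).symm).toRow).submatrix _ _⟩
  ext x y
  simp only [submatrix_apply, Matrix.sum_apply]
  rfl

/-- Dephasing is the channel that measures the qubit in the computational basis. -/
lemma PurifiedLE.dephaseA {θ C : ℝ}
    {ρ : Matrix ((A × Fin 2) × B) ((A × Fin 2) × B) ℂ} (h : PurifiedLE θ C ρ) :
    PurifiedLE θ C (dephaseA ρ) := by
  classical
  let K : Fin 2 → Matrix (A × Fin 2) (A × Fin 2) ℂ :=
    fun τ => diagonal fun x => if x.2 = τ then 1 else 0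
  have hK : ∑ i, (K i).conjTranspose * K i = 1 := by
    simp only [K, diagonal_conjTranspose, diagonal_mul_diagonal]
    ext ⟨a, s⟩ ⟨b, t⟩
    fin_cases s <;> simp [diagonal_apply, Matrix.one_apply]
  convert h.localA hK using 1
  ext ⟨⟨a, s⟩, b⟩ ⟨⟨a', s'⟩, b'⟩
  simp only [K, ← diagonal_one, diagonal_kronecker_diagonal, diagonal_conjTranspose,
    Matrix.sum_apply, diagonal_mul, mul_diagonal]
  fin_cases s <;> fin_cases s' <;> simp [_root_.dephaseA]

lemma PurifiedLE.dephaseB {θ C : ℝ}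
    {ρ : Matrix (A × (Fin 2 × B)) (A × (Fin 2 × B)) ℂ} (h : PurifiedLE θ C ρ) :
    PurifiedLE θ C (dephaseB ρ) := by
  classical
  let K : Fin 2 → Matrix (Fin 2 × B) (Fin 2 × B) ℂ :=
    fun τ => diagonal fun x => if x.1 = τ then 1 else 0
  have hK : ∑ i, (K i).conjTranspose * K i = 1 := by
    simp only [K, diagonal_conjTranspose, diagonal_mul_diagonal]
    ext ⟨s, a⟩ ⟨t, b⟩
    fin_cases s <;> simp [diagonal_apply, Matrix.one_apply]
  convert h.localB hK using 1
  ext ⟨a, s, b⟩ ⟨a', s', b'⟩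
  simp only [K, ← diagonal_one, diagonal_kronecker_diagonal, diagonal_conjTranspose,
    Matrix.sum_apply, diagonal_mul, mul_diagonal]
  fin_cases s <;> fin_cases s' <;> simp [_root_.dephaseB]

/-- Every transmitted qubit or bit costs a factor `2 ^ θ`, and local operations are free. -/
lemma Reachable.purifiedLE {A₀ B₀ : Type} [Fintype A₀] [Fintype B₀] {θ C : ℝ} (h0 : 0 < θ)
    (h1 : θ ≤ 1) {ρ₀ : Matrix (A₀ × B₀) (A₀ × B₀) ℂ} (hρ₀ : PurifiedLE θ C ρ₀)
    {ρ : Matrix (A × B) (A × B) ℂ} {n : ℕ} (h : Reachable ρ₀ A B ρ n) :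
    PurifiedLE θ ((2 ^ θ) ^ n * C) ρ := by
  induction h with
  | init => simpa using hρ₀
  | localA K hK _ ih => exact ih.localA hK
  | localB K hK _ ih => exact ih.localB hK
  | qubitAB _ ih => simpa only [pow_succ', mul_assoc] using ih.qubitAB h0 h1
  | qubitBA _ ih => simpa only [pow_succ', mul_assoc] using ih.qubitBA
  | bitAB _ ih => simpa only [pow_succ', mul_assoc] using ih.dephaseA.qubitAB h0 h1
  | bitBA _ ih => simpa only [pow_succ', mul_assoc] using ih.dephaseB.qubitBA

/-- The amplitudes of a bipartite pure state, as a matrix. -/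
def PureState.ampMatrix (ψ : PureState A B) : Matrix A B ℂ := Matrix.of fun a b => ψ.amp (a, b)

/-- The fidelity of `ρ` with a pure state is, up to normalization, the overlap of the purification
of `ρ` with the tensor product of the pure state and the vector `η` of environment amplitudes
onto which the pure state projects the purification. -/
lemma PurifiedLE.fidelity_sq_le [DecidableEq A] [DecidableEq B] {θ C G : ℝ}
    {ρ : Matrix (A × B) (A × B) ℂ}
    (h : PurifiedLE θ C ρ) (ψ : PureState A B)
    (hψ : ∀ (I J : Type) [Fintype I] [Fintype J] (η : Matrix I J ℂ),
      ∑ i, ∑ j, ‖η i j‖ ^ 2 = 1 → SchattenDualLE θ (ψ.ampMatrix ⊗ₖ η) G)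
    (hC : 0 ≤ C) (hG : 0 ≤ G) : fidelity ψ.proj ρ ^ 2 ≤ C * G := by
  obtain ⟨I, J, _, _, M, rfl, hM⟩ := h
  let N : Matrix I J ℂ := Matrix.of fun i j => star ψ.amp ⬝ᵥ slice M i j
  set c : ℝ := ∑ i, ∑ j, ‖N i j‖ ^ 2 with hc
  have hc0 : 0 ≤ c := by positivity
  have hF : fidelity ψ.proj (∑ i, ∑ j, vecMulVec (slice M i j) (star (slice M i j))) = √c := by
    refine fidelity_vecMulVec ψ.normalized ?_
    simp only [Matrix.sum_mulVec, dotProduct_sum, vecMulVec_mulVec, hc]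
    push_cast
    refine Finset.sum_congr rfl fun i _ => Finset.sum_congr rfl fun j _ => ?_
    have : star (slice M i j) ⬝ᵥ ψ.amp = star (N i j) := by
      rw [star_dotProduct]; rfl
    rw [this, ← Complex.conj_mul']
    simp [N]
  rw [hF, Real.sq_sqrt hc0]
  rcases hc0.eq_or_lt with h0 | h0
  · rw [← h0]; exact mul_nonneg hC hG
  have hs0 : 0 < √c := Real.sqrt_pos.2 h0
  have hη := hψ I J ((√c)⁻¹ • N) (by
    simp only [Matrix.smul_apply, norm_smul, mul_pow, ← Finset.mul_sum]
    rw [← hc, Real.norm_of_nonneg (by positivity), inv_pow, Real.sq_sqrt hc0,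
      inv_mul_cancel₀ h0.ne'])
  have h1 := hM _ _ hη
  have h2 : ((ψ.ampMatrix ⊗ₖ ((√c)⁻¹ • N))ᴴ * M).trace = ((√c : ℝ) : ℂ) := by
    have e : ((ψ.ampMatrix ⊗ₖ ((√c)⁻¹ • N))ᴴ * M).trace
        = ∑ i, ∑ j, (((√c)⁻¹ : ℝ) : ℂ) * (star (N i j) * N i j) := by
      simp only [Matrix.trace, Matrix.diag, Matrix.mul_apply, conjTranspose_apply,
        kroneckerMap_apply, Fintype.sum_prod_type, PureState.ampMatrix, Matrix.of_apply,
        Matrix.smul_apply]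
      have e3 : ∀ i j, N i j = ∑ b, ∑ a, star (ψ.amp (a, b)) * M (a, i) (b, j) := by
        intro i j
        simp only [N, Matrix.of_apply, dotProduct, Fintype.sum_prod_type, slice, Pi.star_apply]
        exact Finset.sum_comm
      have e2 : ∀ i j, (((√c)⁻¹ : ℝ) : ℂ) * (star (N i j) * N i j)
          = ∑ b, ∑ a, star (ψ.amp (a, b) * (√c)⁻¹ • N i j) * M (a, i) (b, j) := by
        intro i j
        nth_rewrite 2 [e3]
        generalize N i j = z
        simp only [Finset.mul_sum]
        refine Finset.sum_congr rfl fun b _ => Finset.sum_congr rfl fun a _ => ?_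
        simp only [Complex.real_smul, star_mul', RCLike.star_def, Complex.conj_ofReal]
        ring
      simp only [e2]
      rw [Finset.sum_comm, Finset.sum_comm (s := (Finset.univ : Finset I))]
      refine Finset.sum_congr rfl fun j _ => ?_
      rw [Finset.sum_comm (s := (Finset.univ : Finset I))]
      exact Finset.sum_congr rfl fun b _ => Finset.sum_comm
    rw [e]
    simp only [← Finset.mul_sum, RCLike.star_def, Complex.conj_mul']
    have : (∑ i, ∑ j, (‖N i j‖ : ℂ) ^ 2) = (c : ℂ) := by rw [hc]; push_cast; rfl
    rw [this, ← Complex.ofReal_mul]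
    congr 1
    rw [inv_mul_eq_div, Real.div_sqrt]
  rw [h2, Complex.norm_real, Real.norm_of_nonneg hs0.le, Real.sq_sqrt hc0] at h1
  exact h1

end Purification

/-! ### Spectra and Rényi entropies -/

section RenyiBounds

variable {A B : Type} [Fintype A] [Fintype B]

lemma PureState.ampMatrix_mul_conjTranspose (ψ : PureState A B) :
    ψ.ampMatrix * ψ.ampMatrixᴴ = ψ.reducedA.mat := by
  ext a a'
  simp [PureState.ampMatrix, PureState.reducedA, partialTraceB, PureState.proj,
    Matrix.mul_apply, vecMulVec_apply]

/-- Tensoring with `Φ^k` divides the eigenvalues of the reduced state by `k` and multiplies their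
multiplicities by `k`. -/
lemma PureState.spectral_tensor_maxEntangled [DecidableEq A] (ψ : PureState A B) {k : ℕ}
    (hk : 0 < k) :
    ∃ V : Matrix (A × Fin k) (A × Fin k) ℂ, Vᴴ * V = 1 ∧ V * Vᴴ = 1 ∧
      (ψ.tensor (maxEntangled k hk)).ampMatrix * (ψ.tensor (maxEntangled k hk)).ampMatrixᴴ
        = V * diagonal (fun p =>
            ((ψ.reducedA.posSemidef.isHermitian.eigenvalues p.1 / k : ℝ) : ℂ)) * Vᴴ := by
  obtain ⟨V, hV, hV', hs⟩ := exists_isometry_spectral ψ.reducedA.posSemidef.isHermitian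
  refine ⟨V ⊗ₖ 1, ?_, ?_, ?_⟩
  · rw [conjTranspose_kronecker, ← mul_kronecker_mul, hV, conjTranspose_one, Matrix.one_mul,
      one_kronecker_one]
  · rw [conjTranspose_kronecker, ← mul_kronecker_mul, hV', conjTranspose_one, Matrix.one_mul,
      one_kronecker_one]
  · have e1 : (ψ.tensor (maxEntangled k hk)).ampMatrix
        = ψ.ampMatrix ⊗ₖ diagonal fun _ : Fin k => ((1 / √(k : ℝ) : ℝ) : ℂ) := by
      ext ⟨a, i⟩ ⟨b, j⟩
      simp [PureState.ampMatrix, PureState.tensor, maxEntangled, diagonal_apply]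
    have hk0 : (0 : ℝ) ≤ k := by positivity
    have e2 : (diagonal fun _ : Fin k => ((1 / √(k : ℝ) : ℝ) : ℂ))
        * (diagonal fun _ : Fin k => ((1 / √(k : ℝ) : ℝ) : ℂ))ᴴ
        = diagonal fun _ => ((1 / k : ℝ) : ℂ) := by
      rw [diagonal_conjTranspose, diagonal_mul_diagonal]
      congr 1
      funext _
      rw [Pi.star_apply, RCLike.star_def, Complex.conj_ofReal, ← Complex.ofReal_mul,
        div_mul_div_comm, Real.mul_self_sqrt hk0, one_mul]
    have e3 : (diagonal fun p : A × Fin k =>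
          ((ψ.reducedA.posSemidef.isHermitian.eigenvalues p.1 / k : ℝ) : ℂ))
        = diagonal (fun i => (ψ.reducedA.posSemidef.isHermitian.eigenvalues i : ℂ)) ⊗ₖ
          diagonal fun _ => ((1 / k : ℝ) : ℂ) := by
      rw [diagonal_kronecker_diagonal]
      congr 1
      funext p
      push_cast
      ring
    rw [e1, conjTranspose_kronecker, ← mul_kronecker_mul, e2, ψ.ampMatrix_mul_conjTranspose, e3,
      conjTranspose_kronecker, ← mul_kronecker_mul, ← mul_kronecker_mul, ← hs, Matrix.one_mul,
      conjTranspose_one, Matrix.mul_one]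

lemma DensityMatrix.sum_eigenvalues [DecidableEq A] (ρ : DensityMatrix A) :
    ∑ i, ρ.posSemidef.isHermitian.eigenvalues i = 1 := by
  have h := ρ.posSemidef.isHermitian.trace_eq_sum_eigenvalues
  rw [ρ.trace_eq_one] at h
  apply Complex.ofReal_injective
  rw [Complex.ofReal_one, h]
  push_cast
  rfl

lemma DensityMatrix.exists_eigenvalue_pos [DecidableEq A] (ρ : DensityMatrix A) :
    ∃ i, 0 < ρ.posSemidef.isHermitian.eigenvalues i := by
  by_contra! h
  have := Finset.sum_nonpos fun i (_ : i ∈ Finset.univ) => h i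
  rw [ρ.sum_eigenvalues] at this
  linarith

lemma DensityMatrix.sum_eigenvalues_rpow_pos [DecidableEq A] (ρ : DensityMatrix A) (p : ℝ) :
    0 < ∑ i, ρ.posSemidef.isHermitian.eigenvalues i ^ p := by
  obtain ⟨i, hi⟩ := ρ.exists_eigenvalue_pos
  exact Finset.sum_pos' (fun j _ => Real.rpow_nonneg (ρ.posSemidef.eigenvalues_nonneg j) _)
    ⟨i, Finset.mem_univ i, Real.rpow_pos_of_pos hi _⟩

lemma renyiEntropy_ofReal [DecidableEq A] (ρ : DensityMatrix A) {α : ℝ} (h0 : 0 < α)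
    (h1 : α ≠ 1) : renyiEntropy (ENNReal.ofReal α) ρ
      = 1 / (1 - α) * Real.logb 2 (∑ i, ρ.posSemidef.isHermitian.eigenvalues i ^ α) := by
  rw [renyiEntropy, if_neg (by simpa using h0), if_neg (by simpa using h1),
    if_neg ENNReal.ofReal_ne_top, ENNReal.toReal_ofReal h0.le]

/-- `2 ^ (-θ S_β(ρ))` with `θ = 1 / α - 1` is the norm of exponent `β` of the spectrum of `ρ`. -/
lemma exists_holderLE_logb_eq [DecidableEq A] (ρ : DensityMatrix A) {α : ℝ} (hα : 1 / 2 ≤ α)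
    (hα1 : α < 1) :
    ∃ G : ℝ, 0 < G ∧ HolderLE (1 / α - 1) ρ.posSemidef.isHermitian.eigenvalues G ∧
      Real.logb 2 G = -(1 / α - 1) * renyiEntropy (conjOrder α) ρ := by
  set l := ρ.posSemidef.isHermitian.eigenvalues with hl
  have hl0 : ∀ i, 0 ≤ l i := ρ.posSemidef.eigenvalues_nonneg
  have hα0 : 0 < α := by linarith
  rcases hα.eq_or_lt with h | h
  · subst h
    obtain ⟨i, hi⟩ := ρ.exists_eigenvalue_pos
    have hbdd : BddAbove (Set.range l) := Set.finite_range l |>.bddAbove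
    have hle : ∀ j, l j ≤ ⨆ j, l j := fun j => le_ciSup hbdd j
    refine ⟨⨆ j, l j, hi.trans_le (hle i), ?_, ?_⟩
    · intro s hs hs1
      have e : (1 / (1 / 2 : ℝ) - 1) = 1 := by norm_num
      rw [e]
      calc ∑ k, s k ^ (1 : ℝ) * l k ≤ ∑ k, s k * ⨆ j, l j := by
            refine Finset.sum_le_sum fun k _ => ?_
            rw [Real.rpow_one]
            exact mul_le_mul_of_nonneg_left (hle k) (hs k)
        _ ≤ _ := by
            rw [← Finset.sum_mul]
            exact mul_le_of_le_one_left (hi.le.trans (hle i)) hs1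
    · rw [conjOrder, if_pos rfl, renyiEntropy, if_neg ENNReal.top_ne_zero,
        if_neg ENNReal.top_ne_one, if_pos rfl]
      norm_num
      rfl
  · have h2 : 0 < 2 * α - 1 := by linarith
    set β := α / (2 * α - 1) with hβ
    have hβ1 : 1 < β := by rw [hβ, lt_div_iff₀ h2]; linarith
    have hθ : 0 < 1 / α - 1 := by rw [sub_pos, lt_div_iff₀ hα0]; linarith
    have hβθ : 1 / β = 1 - (1 / α - 1) := by
      rw [hβ]; field_simp; ring
    have hZ := ρ.sum_eigenvalues_rpow_pos β
    refine ⟨(∑ i, l i ^ β) ^ (1 / β), Real.rpow_pos_of_pos hZ _, ?_, ?_⟩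
    · intro s hs hs1
      have hpq : (1 / (1 / α - 1)).HolderConjugate β := by
        rw [Real.holderConjugate_iff]
        refine ⟨?_, ?_⟩
        · rw [lt_div_iff₀ hθ, one_mul, sub_lt_iff_lt_add, div_lt_iff₀ hα0]; linarith
        · rw [← one_div β, hβθ]; simp
      have h3 := Real.inner_le_Lp_mul_Lq_of_nonneg Finset.univ hpq
        (f := fun k => s k ^ (1 / α - 1)) (g := l)
        (fun k _ => Real.rpow_nonneg (hs k) _) (fun k _ => hl0 k)
      refine h3.trans ?_
      have h4 : ∀ k, (s k ^ (1 / α - 1)) ^ (1 / (1 / α - 1)) = s k := by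
        intro k
        rw [one_div (1 / α - 1), Real.rpow_rpow_inv (hs k) hθ.ne']
      simp only [h4]
      refine mul_le_of_le_one_left (Real.rpow_nonneg hZ.le _) ?_
      exact Real.rpow_le_one (Finset.sum_nonneg fun k _ => hs k) hs1 (by simpa using hθ.le)
    · rw [conjOrder, if_neg h.ne', ← hβ, renyiEntropy_ofReal ρ (by linarith) hβ1.ne',
        Real.logb_rpow_eq_mul_logb_of_pos hZ, ← mul_assoc]
      congr 1
      have hβ' : 1 - β ≠ 0 := by linarith
      have : 1 / α - 1 = 1 - 1 / β := by rw [hβθ]; ring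
      rw [this]
      have : β ≠ 0 := by linarith
      field_simp
      ring

end RenyiBounds

/-! ### The bound on the communication -/

section ComplexityBound

variable {A₀ B₀ A B : Type} [Fintype A₀] [Fintype B₀] [Fintype A] [Fintype B]

lemma PureState.purifiedLE_proj {θ C : ℝ} (φ : PureState A B) (h : SchattenLE θ φ.ampMatrix C) :
    PurifiedLE θ C φ.proj := by
  refine ⟨Unit, Unit, inferInstance, inferInstance,
    φ.ampMatrix.submatrix (Equiv.prodPUnit A) (Equiv.prodPUnit B), ?_, h.submatrix _ _⟩
  simp only [Finset.univ_unique, Finset.sum_singleton]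
  rfl

/-- For `ε = 0`, where approximation means equality, the bound is the fidelity `1` of a pure state
with itself. -/
lemma Approximates.le_fidelity [DecidableEq A] [DecidableEq B] {ε : ℝ} {ψ : PureState A B}
    {ρ : Matrix (A × B) (A × B) ℂ} (h : Approximates ε ψ.proj ρ) :
    1 - ε ≤ fidelity ψ.proj ρ := by
  rcases h with h | ⟨rfl, rfl⟩
  · exact h.le
  · have hvv : star ψ.amp ⬝ᵥ ψ.amp = 1 := by
      simp only [dotProduct, Pi.star_apply, RCLike.star_def, Complex.conj_mul']
      exact_mod_cast ψ.normalized
    have := fidelity_vecMulVec ψ.normalized (σ := ψ.proj) (c := 1) (by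
      rw [PureState.proj, vecMulVec_mulVec, hvv]; simp [hvv])
    rw [PureState.proj] at this ⊢
    rw [this]
    simp

/-- The powers of `k` that `Φ^k` contributes to the two Schatten norms cancel, so that the bound
does not depend on `k`. -/
lemma le_of_reachable_of_approximates [DecidableEq A₀] [DecidableEq A] [DecidableEq B]
    (φ : PureState A₀ B₀) (ψ : PureState A B) {ε : ℝ} (hε1 : ε < 1)
    {α : ℝ} (hα : 1 / 2 ≤ α) (hα1 : α < 1) {k : ℕ} (hk : 0 < k) {n : ℕ}
    {ρ : Matrix ((A × Fin k) × (B × Fin k)) ((A × Fin k) × (B × Fin k)) ℂ}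
    (hρ : Reachable (φ.tensor (maxEntangled k hk)).proj (A × Fin k) (B × Fin k) ρ n)
    (h : Approximates ε (ψ.tensor (maxEntangled k hk)).proj ρ) :
    renyiEntropy (conjOrder α) ψ.reducedA - renyiEntropy (ENNReal.ofReal α) φ.reducedA
        + 2 * α / (1 - α) * Real.logb 2 (1 - ε) ≤ n := by
  have hα0 : 0 < α := by linarith
  have hk' : (0 : ℝ) < k := by exact_mod_cast hk
  have hθ : 0 < 1 / α - 1 := by rw [sub_pos, lt_div_iff₀ hα0]; linarith
  have hθ1 : 1 / α - 1 ≤ 1 := by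
    rw [sub_le_iff_le_add, div_le_iff₀ hα0]; linarith
  obtain ⟨G, hG0, hG, hGlog⟩ := exists_holderLE_logb_eq ψ.reducedA hα hα1
  obtain ⟨V, hV, hV', hVφ⟩ := φ.spectral_tensor_maxEntangled hk
  obtain ⟨W, hW, -, hWψ⟩ := ψ.spectral_tensor_maxEntangled hk
  set l := φ.reducedA.posSemidef.isHermitian.eigenvalues with hl
  have hl0 : ∀ i, 0 ≤ l i := φ.reducedA.posSemidef.eigenvalues_nonneg
  have hm0 := ψ.reducedA.posSemidef.eigenvalues_nonneg
  have hZ : 0 < ∑ i, l i ^ α := φ.reducedA.sum_eigenvalues_rpow_pos α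
  set Z := ∑ i, l i ^ α with hZdef
  have hφ := schattenLE_of_singularValues hα0 hV hV' hVφ
  have hsum : (∑ p : A₀ × Fin k, (l p.1 / k) ^ α) ^ (1 / α)
      = (k : ℝ) ^ (1 / α - 1) * Z ^ (1 / α) := by
    have : ∑ p : A₀ × Fin k, (l p.1 / k) ^ α = (k : ℝ) ^ (1 - α) * Z := by
      rw [Fintype.sum_prod_type, hZdef, Finset.mul_sum]
      refine Finset.sum_congr rfl fun i _ => ?_
      dsimp only
      rw [Finset.sum_const, Finset.card_univ, Fintype.card_fin, nsmul_eq_mul,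
        Real.div_rpow (hl0 i) hk'.le, Real.rpow_sub hk', Real.rpow_one]
      ring
    rw [this, Real.mul_rpow (by positivity) hZ.le, ← Real.rpow_mul hk'.le]
    congr 2
    field_simp
  rw [hsum] at hφ
  have hfin := (hρ.purifiedLE hθ hθ1 (PureState.purifiedLE_proj _ hφ)).fidelity_sq_le
    (ψ.tensor (maxEntangled k hk)) (G := G / (k : ℝ) ^ (1 / α - 1))
    (fun I J _ _ η hη => schattenDualLE_kronecker hθ hθ1 hW
      (fun p => div_nonneg (hm0 p.1) hk'.le) hWψ hη (hG.prod_const hθ hθ1 hm0 hk))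
    (by positivity) (by positivity)
  have hF := h.le_fidelity
  have h1ε : 0 < 1 - ε := by linarith
  have hkey : (1 - ε) ^ 2 ≤ (2 ^ (1 / α - 1)) ^ n * Z ^ (1 / α) * G := by
    refine (pow_le_pow_left₀ h1ε.le hF 2).trans (hfin.trans_eq ?_)
    have : (k : ℝ) ^ (1 / α - 1) ≠ 0 := by positivity
    field_simp
  have hlog := Real.logb_le_logb_of_le one_lt_two (by positivity) hkey
  rw [Real.logb_mul (by positivity) hG0.ne', Real.logb_mul (by positivity) (by positivity),
    Real.logb_pow, Real.logb_pow, Real.logb_rpow (by norm_num) (by norm_num),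
    Real.logb_rpow_eq_mul_logb_of_pos hZ, hGlog] at hlog
  have hSα : 1 / α * Real.logb 2 Z
      = (1 / α - 1) * renyiEntropy (ENNReal.ofReal α) φ.reducedA := by
    rw [renyiEntropy_ofReal _ hα0 hα1.ne, ← mul_assoc]
    congr 1
    have : 1 - α ≠ 0 := by linarith
    field_simp
  rw [hSα] at hlog
  have h2θ : 2 * α / (1 - α) = 2 / (1 / α - 1) := by
    have : 1 - α ≠ 0 := by linarith
    field_simp
  push_cast at hlog
  have : 2 / (1 / α - 1) * Real.logb 2 (1 - ε)
      ≤ n + renyiEntropy (ENNReal.ofReal α) φ.reducedA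
        - renyiEntropy (conjOrder α) ψ.reducedA := by
    rw [div_mul_eq_mul_div, div_le_iff₀ hθ]
    linarith
  rw [h2θ]
  linarith

end ComplexityBound

end

theorem mainTheorem1 {A₀ B₀ A B : Type} [Fintype A₀] [Fintype B₀] [Fintype A] [Fintype B]
    [DecidableEq A₀] [DecidableEq A] [DecidableEq B]
    (φ : PureState A₀ B₀) (ψ : PureState A B) (ε : ℝ) (hε0 : 0 ≤ ε) (hε1 : ε < 1)
    (α : ℝ) (hα : 1 / 2 ≤ α) (hα1 : α < 1) :
    ((renyiEntropy (conjOrder α) ψ.reducedA - renyiEntropy (ENNReal.ofReal α) φ.reducedA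
        + 2 * α / (1 - α) * Real.logb 2 (1 - ε) : ℝ) : EReal)
      ≤ (((eprTransformationComplexity ε ψ φ : ℕ∞) : ℝ≥0∞) : EReal) := by
  rcases h : eprTransformationComplexity ε ψ φ with _ | N
  -- If no protocol succeeds, the complexity is infinite.
  · exact le_top
  · have hlt : eprTransformationComplexity ε ψ φ < ((N + 1 : ℕ) : ℕ∞) := by
      rw [h]; exact WithTop.coe_lt_coe.2 (Nat.lt_succ_self N)
    simp only [eprTransformationComplexity, transformationComplexity, iInf_lt_iff] at hlt
    obtain ⟨k, hk, n, ⟨ρ, hρ, hap⟩, hn⟩ := hlt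
    have hnN : n ≤ N := Nat.lt_succ_iff.1 (by exact_mod_cast hn)
    have := le_of_reachable_of_approximates φ ψ hε1 hα hα1 hk hρ hap
    have h2 := this.trans (Nat.cast_le (α := ℝ).2 hnN)
    refine (EReal.coe_le_coe_iff.2 h2).trans_eq ?_
    change ((N : ℝ) : EReal) = (((N : ℕ∞) : ℝ≥0∞) : EReal)
    rw [ENat.toENNReal_coe]
    rfl
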